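/- A monoid $M$ is *atomic* if there is $\nu:M\to\mathbb N$ with $\nu(a)=0\iff a=1$ and $\nu(ab)\ge\nu(a)+\nu(b)$. Write $a\le_L b$ if $ac=b$ for some $c\in M$, and $a\le_R b$ if $ca=b$ for some $c\in M$. A *Garside element* of $M$ is a $\Delta\in M$ such that $\{a: a\le_L\Delta\}=\{a: a\le_R\Delta\}$ and this set generates $M$. A *Garside monoid* is a finitely generated, atomic, cancellative monoid such that $(M,\le_L)$ and $(M,\le_R)$ are lattices and which has a Garside element. Its group of fractions $G=G(M)$ is the group with generating set $M$ and relations $a\cdot b=c$ whenever $ab=c$ in $M$; a Garside group is a group of this form. We identify $M$ with its image in $G$ and, for $\alpha,\beta\in G$, write $\alpha\le_L\beta$ if $\alpha^{-1}\beta\in M$; $\wedge_L$ denotes the meet for $\le_L$. Let $M$ be a Garside monoid, $G=G(M)$, let $\Delta$ be a fixed Garside element, and let $\mathcal S=\{a\in M: a\le_L\Delta\}$ be the set of simple elements. If $G$ is nontrivial, every $\alpha\in G$ has a unique $\Delta$-normal form $\alpha=\Delta^p a_1\cdots a_r$, where $p\in\mathbb Z$ is the greatest integer with $\Delta^{-p}\alpha\in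 M$, $a_i\ne1$, and $a_i=\Delta\wedge_L(a_ia_{i+1}\cdots a_r)$ for $1\le i\le r$. Let $i(\alpha)=\Delta^pa_1\Delta^{-p}$ and $t(\alpha)=a_r$ if $r\ge1$, and $i(\alpha)=1$, $t(\alpha)=\Delta$ if $r=0$. The *sliding* of $\alpha$ is $S(\alpha)=\pi(\alpha)^{-1}\alpha\,\pi(\alpha)$, where $\pi(\alpha)=i(\alpha)\wedge_L\bigl(t(\alpha)^{-1}\Delta\bigr)$. (If $G$ is trivial, $S$ is the identity.) The set of *sliding circuits* of $\alpha$ is $$SC(\alpha)=\{\beta\in G:\ \beta\text{ is conjugate to }\alpha\text{ and }S^m(\beta)=\beta\text{ for some }m\ge1\}.$$ **Corollary.** (1) For every $\alpha\in G$, let $\Omega_\alpha$ be the graph with vertex set $SC(\alpha)$ in which two vertices $\beta,\beta'$ are joined by an edge if $\beta'=a^{-1}\beta a$ or $\beta=a^{-1}\beta'a$ for some $a\in\mathcal S$. Then $\Omega_\alpha$ is connected (in particular non-empty). (2) Let $x_1,\dots,x_n$ be any finite family generating the group $G$. There is an algorithm which, given a word $w$ in the letters $x_i^{\pm1}$ representing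 $\alpha\in G$, computes a finite list of words such that the elements of $G$ they represent are exactly the elements of $SC(\alpha)$; and there is an algorithm which solves the conjugacy problem for $G$, that is, which decides, given two words in the letters $x_i^{\pm1}$, whether the elements of $G$ they represent are conjugate. -/

import Mathlib

universe u

namespace Garside

/-! ### Garside monoids -/

section Orders

/-- `d` is a greatest lower bound of `a` and `b` for the relation `le`. -/
def IsMeet {X : Type u} (le : X → X → Prop) (a b d : X) : Prop :=
  le d a ∧ le d b ∧ ∀ c, le c a → le c b → le c d

/-- `d` is a least upper bound of `a` and `b` for the relation `le`. -/
def IsJoin {X : Type u} (le : X → X → Prop) (a b d : X) : Prop :=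
  le a d ∧ le b d ∧ ∀ c, le a c → le b c → le d c

end Orders

section Monoids

variable {M : Type u} [Monoid M]

/-- `Δ` is a Garside element: its left divisors and its right divisors form the same set,
and this set generates the monoid. -/
structure IsGarsideElement (Δ : M) : Prop where
  divisors_eq : {a : M | a ∣ Δ} = {a : M | a ∣ᵣ Δ}
  generates : Submonoid.closure {a : M | a ∣ Δ} = ⊤

variable (M) in
/-- Garside monoids: atomic, finitely generated, cancellative, both divisibility orders are
lattices, and there is a Garside element. Here `a ∣ b` is left divisibility (`b = a c` for
some `c`) and `a ∣ᵣ b` is right divisibility (`b = c a` for some `c`). (Divisibility is reflexive and transitive in any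
monoid, and antisymmetric in an atomic cancellative one.) -/
structure IsGarsideMonoid : Prop where
  atomic : ∃ ν : M → ℕ, (∀ a, ν a = 0 ↔ a = 1) ∧ ∀ a b, ν a + ν b ≤ ν (a * b)
  fg : Monoid.FG M
  cancel : ∀ a b b' c : M, a * b * c = a * b' * c → b = b'
  left_meet : ∀ a b : M, ∃ d, IsMeet (· ∣ ·) a b d
  left_join : ∀ a b : M, ∃ d, IsJoin (· ∣ ·) a b d
  right_meet : ∀ a b : M, ∃ d, IsMeet (· ∣ᵣ ·) a b d
  right_join : ∀ a b : M, ∃ d, IsJoin (· ∣ᵣ ·) a b d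
  garside : ∃ Δ : M, IsGarsideElement Δ

/-- The relations `a · b = ab` defining the group of fractions. -/
def fracRels (M : Type u) [Monoid M] : Set (FreeGroup M) :=
  {r | ∃ a b : M, r = FreeGroup.of a * FreeGroup.of b * (FreeGroup.of (a * b))⁻¹}

/-- The group of fractions `G(M)`: the group presented by the generating set `M` and the relations
`a · b = c` whenever `ab = c` in `M`. -/
abbrev FracGroup (M : Type u) [Monoid M] : Type u := PresentedGroup (fracRels M)

theorem of_mul (a b : M) :
    (PresentedGroup.of (a * b) : FracGroup M) = PresentedGroup.of a * PresentedGroup.of b := by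
  have h : PresentedGroup.mk (fracRels M)
      (FreeGroup.of a * FreeGroup.of b * (FreeGroup.of (a * b))⁻¹) = 1 :=
    PresentedGroup.one_of_mem ⟨a, b, rfl⟩
  rw [map_mul, map_inv, map_mul, mul_inv_eq_one] at h
  exact h.symm

/-- The natural homomorphism `M → G(M)`. -/
def ι : M →* FracGroup M where
  toFun := PresentedGroup.of
  map_one' := by
    have h := of_mul (1 : M) 1
    rw [mul_one] at h
    exact (mul_eq_left.mp h.symm)
  map_mul' := of_mul

/-- The order `≤_L` on `G(M)`: `α ≤_L β` when `α⁻¹ β` lies in `M`. -/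
def LeftLE (α β : FracGroup M) : Prop := ∃ m : M, α⁻¹ * β = ι m

/-! ### Normal forms and cyclic sliding, for a fixed Garside element `Δ` -/

/-- `a₁, …, a_l` is the normal form of the product `a₁ ⋯ a_l`: each `a_i` is nontrivial and
`a_i = Δ ∧_L (a_i ⋯ a_l)` (so that each `a_i` is simple). -/
def IsNormalForm (Δ : M) : List M → Prop
  | [] => True
  | a :: l => a ≠ 1 ∧ IsMeet (· ∣ ·) Δ (a * l.prod) a ∧ IsNormalForm Δ l

/-- `Δ^p a₁ ⋯ a_r` is the `Δ`-normal form of `α`: `p` is the greatest integer such that `α` can be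
written `Δ^p β` with `β ∈ M`, and `a₁, …, a_r` is the normal form of that `β`. -/
def IsDeltaNormalForm (Δ : M) (α : FracGroup M) (p : ℤ) (l : List M) : Prop :=
  α = ι Δ ^ p * ι l.prod ∧
  (∀ (q : ℤ) (b : M), α = ι Δ ^ q * ι b → q ≤ p) ∧
  IsNormalForm Δ l

/-- The `Δ`-normal form `(p, [a₁, …, a_r])` of `α`. It exists and is unique for a nontrivial
Garside monoid; when `M` is trivial, `p` cannot be maximal, but then `G(M)` is trivial too. -/
noncomputable def deltaNormalForm (Δ : M) (α : FracGroup M) : ℤ × List M :=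
  Classical.epsilon fun x : ℤ × List M => IsDeltaNormalForm Δ α x.1 x.2

/-- The initial factor `τ^p(a₁)`, where `τ` is the conjugation `a ↦ Δ a Δ⁻¹`.
It is `1` when `r = 0`. -/
noncomputable def initialFactor (Δ : M) (α : FracGroup M) : FracGroup M :=
  ι Δ ^ (deltaNormalForm Δ α).1 * ι ((deltaNormalForm Δ α).2.headD 1) *
    (ι Δ ^ (deltaNormalForm Δ α).1)⁻¹

/-- The terminal factor `a_r`. It is `Δ` when `r = 0`. -/
noncomputable def terminalFactor (Δ : M) (α : FracGroup M) : FracGroup M :=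
  ι ((deltaNormalForm Δ α).2.getLastD Δ)

/-- The complement `a^*` of a simple element: `a a^* = Δ`. -/
def star (Δ : M) (a : FracGroup M) : FracGroup M := a⁻¹ * ι Δ

/-- The prefix `π(α) = i(α) ∧_L t(α)^*`. -/
noncomputable def slidingPrefix (Δ : M) (α : FracGroup M) : FracGroup M :=
  Classical.epsilon fun d =>
    IsMeet LeftLE (initialFactor Δ α) (star Δ (terminalFactor Δ α)) d

/-- The sliding `S(α) = π(α)⁻¹ α π(α)`. -/
noncomputable def sliding (Δ : M) (α : FracGroup M) : FracGroup M :=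
  (slidingPrefix Δ α)⁻¹ * α * slidingPrefix Δ α

/-- The sliding circuits `SC(α)`: the conjugates `β` of `α` with `S^m(β) = β` for some `m ≥ 1`. -/
def SC (Δ : M) (α : FracGroup M) : Set (FracGroup M) :=
  {β | IsConj β α ∧ ∃ m : ℕ, 1 ≤ m ∧ (sliding Δ)^[m] β = β}

/-- The graph with vertex set `SC(α)`, in which `β` and `β'` are joined when `β' = a⁻¹ β a`
for a simple element `a` (loops are dropped). -/
def circuitGraph (Δ : M) (α : FracGroup M) : SimpleGraph (SC Δ α) :=
  SimpleGraph.fromRel fun β β' =>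
    ∃ a : M, a ∣ Δ ∧ (β' : FracGroup M) = (ι a)⁻¹ * (β : FracGroup M) * ι a

end Monoids

/-! ### Words -/

/-- Words in the letters `x_i` (coded `(i, true)`) and `x_i⁻¹` (coded `(i, false)`). -/
abbrev Word (n : ℕ) : Type := List (Fin n × Bool)

/-- The element of the group represented by a word. -/
def Word.eval {G : Type u} [Group G] {n : ℕ} (x : Fin n → G) (w : Word n) : G :=
  (w.map fun s => if s.2 then x s.1 else (x s.1)⁻¹).prod

end Garside

namespace Garside

/-! ### Groups ordered by a Garside element -/

/-! The proof uses only the order `≤_L` on `G`, through the properties collected in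
`IsGarsideOrder`. There the sliding prefix becomes `Δ ⊓ α Δ^(-inf α) ⊓ α⁻¹ Δ^(-inf α⁻¹)`
(`slidingPrefix_eq_pre`), which is unchanged under `α ↦ α⁻¹`, so sliding commutes with inversion.

Fix `x`, and let `p`, `r` be the infima of `x` and `x⁻¹`. As long as the conjugate `s⁻¹ x s` keeps
these infima, sliding it amounts to replacing `s` by `F s = sΔ ⊓ x s Δ^(-p) ⊓ x⁻¹ s Δ^(-r)`
(`transport`). The map `F` preserves meets and commutes with left multiplication by the centralizer
of `x` and with right multiplication by powers of `Δ`.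

Sliding never lowers either infimum. Once both stay constant forever, no conjugate has a larger one
(`not_le_of_isStable`). So all circuits of a conjugacy class share both infima; they lie in one
finite interval, and `F` governs all conjugators between them. If `s` conjugates a circuit `x` to a
circuit, then `F^N s = z s` and `F^N 1 = z` for some `N ≥ 1` and some `z` centralizing `x`;
conversely `F^N s = z s` together with the infimum conditions gives a circuit. Since `F` preserves
meets, the conjugators from `x` to circuits are closed under meets (`conj_inf_mem_periodicPts`).
Powers of `Δ` are among them, so a positive conjugator `c` can be shortened by `c ⊓ Δ` without
leaving the circuits: this is connectedness.

For the algorithms, positivity of a word is decided by extracting greatest simple divisors, which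
makes the order, equality and sliding computable. One then searches for a finite non-empty list of
circuits closed under conjugation by simple elements and their inverses; by connectedness any such
list is complete. Two elements are conjugate exactly when their lists share an element. -/

/-- A group with a left-invariant meet-semilattice order for which `Δ` behaves like a Garside
element: right multiplication by `Δ` is an order automorphism, the powers of `Δ` are cofinal,
and the intervals `[1, Δ ^ n]` are finite. -/
structure IsGarsideOrder {G : Type u} [Group G] [SemilatticeInf G] (Δ : G) : Prop where
  mul_left_le : ∀ a b c : G, b ≤ c → a * b ≤ a * c
  mul_right_le : ∀ a b : G, a * Δ ≤ b * Δ ↔ a ≤ b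
  one_lt : 1 < Δ
  exists_le_pow : ∀ g : G, ∃ n : ℕ, g ≤ Δ ^ n
  finite_Icc : ∀ n : ℕ, (Set.Icc 1 (Δ ^ n)).Finite

theorem inv_conj {G : Type u} [Group G] (x c : G) : (c⁻¹ * x * c)⁻¹ = c⁻¹ * x⁻¹ * c := by group

namespace IsGarsideOrder

variable {G : Type u} [Group G] [SemilatticeInf G] {Δ : G}

section Basic

theorem mul_le_mul_left_iff (h : IsGarsideOrder Δ) {a b c : G} : a * b ≤ a * c ↔ b ≤ c :=
  ⟨fun H => by simpa using h.mul_left_le a⁻¹ _ _ H, h.mul_left_le a b c⟩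

theorem mul_inf_eq (h : IsGarsideOrder Δ) (a b c : G) : a * (b ⊓ c) = a * b ⊓ a * c := by
  apply le_antisymm
  · exact le_inf (h.mul_left_le _ _ _ inf_le_left) (h.mul_left_le _ _ _ inf_le_right)
  · rw [← h.mul_le_mul_left_iff (a := a⁻¹), inv_mul_cancel_left]
    refine le_inf ?_ ?_ <;> rw [← h.mul_le_mul_left_iff (a := a), mul_inv_cancel_left]
    exacts [inf_le_left, inf_le_right]

theorem mul_pow_le_iff (h : IsGarsideOrder Δ) (n : ℕ) {a b : G} :
    a * Δ ^ n ≤ b * Δ ^ n ↔ a ≤ b := by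
  induction n with
  | zero => simp
  | succ n ih => rw [pow_succ, ← mul_assoc, ← mul_assoc, h.mul_right_le, ih]

theorem mul_zpow_le_iff (h : IsGarsideOrder Δ) (z : ℤ) {a b : G} :
    a * Δ ^ z ≤ b * Δ ^ z ↔ a ≤ b := by
  obtain ⟨n, rfl | rfl⟩ := z.eq_nat_or_neg
  · simpa using h.mul_pow_le_iff n
  · rw [← h.mul_pow_le_iff n]; simp

theorem le_mul_zpow_iff (h : IsGarsideOrder Δ) (z : ℤ) {a b : G} :
    a ≤ b * Δ ^ z ↔ a * Δ ^ (-z) ≤ b := by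
  rw [← h.mul_zpow_le_iff (-z)]; simp

theorem inf_mul_zpow (h : IsGarsideOrder Δ) (z : ℤ) (a b : G) :
    (a ⊓ b) * Δ ^ z = a * Δ ^ z ⊓ b * Δ ^ z := by
  apply le_antisymm
  · exact le_inf ((h.mul_zpow_le_iff z).2 inf_le_left) ((h.mul_zpow_le_iff z).2 inf_le_right)
  · rw [h.le_mul_zpow_iff]
    refine le_inf ?_ ?_ <;> rw [← h.le_mul_zpow_iff]
    exacts [inf_le_left, inf_le_right]

theorem one_le_pow (h : IsGarsideOrder Δ) (n : ℕ) : 1 ≤ Δ ^ n := by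
  induction n with
  | zero => simp
  | succ n ih =>
    calc 1 ≤ Δ := h.one_lt.le
      _ = 1 * Δ := (one_mul _).symm
      _ ≤ Δ ^ n * Δ := (h.mul_right_le _ _).2 ih
      _ = Δ ^ (n + 1) := (pow_succ _ _).symm

theorem zpow_mono (h : IsGarsideOrder Δ) {a b : ℤ} (hab : a ≤ b) : Δ ^ a ≤ Δ ^ b := by
  obtain ⟨n, rfl⟩ := Int.le.dest hab
  rw [zpow_add, ← h.mul_le_mul_left_iff (a := (Δ ^ a)⁻¹)]
  simpa using h.one_le_pow n

theorem zpow_le_iff (h : IsGarsideOrder Δ) {a b : ℤ} : Δ ^ a ≤ Δ ^ b ↔ a ≤ b := by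
  refine ⟨fun H => ?_, h.zpow_mono⟩
  by_contra! hlt
  have h1 : Δ ^ (b + 1) ≤ Δ ^ b := (h.zpow_mono (by omega)).trans H
  rw [zpow_add, zpow_one] at h1
  have h2 : Δ ^ b * Δ ≤ Δ ^ b * 1 := by simpa using h1
  rw [h.mul_le_mul_left_iff] at h2
  exact absurd h.one_lt (not_lt_of_ge h2)

theorem exists_zpow_bounds (h : IsGarsideOrder Δ) (g : G) :
    ∃ n : ℕ, Δ ^ (-(n : ℤ)) ≤ g ∧ g ≤ Δ ^ (n : ℤ) := by
  obtain ⟨a, ha⟩ := h.exists_le_pow g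
  obtain ⟨b, hb⟩ := h.exists_le_pow g⁻¹
  refine ⟨a + b, ?_, ?_⟩
  · have : (1 : G) ≤ g * Δ ^ (b : ℤ) := by
      rw [← h.mul_le_mul_left_iff (a := g⁻¹)]; simpa using hb
    rw [h.le_mul_zpow_iff, one_mul] at this
    exact (h.zpow_mono (by push_cast; omega)).trans this
  · rw [← zpow_natCast] at ha
    exact ha.trans (h.zpow_mono (by push_cast; omega))

theorem finite_Icc_all (h : IsGarsideOrder Δ) (a b : G) : (Set.Icc a b).Finite := by
  obtain ⟨n, hn, -⟩ := h.exists_zpow_bounds a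
  obtain ⟨m, -, hm⟩ := h.exists_zpow_bounds b
  refine ((h.finite_Icc (m + n)).image (· * Δ ^ (-(n : ℤ)))).subset ?_
  rintro g ⟨hag, hgb⟩
  refine ⟨g * Δ ^ (n : ℤ), ⟨?_, ?_⟩, by simp⟩
  · rw [h.le_mul_zpow_iff, one_mul]
    exact hn.trans hag
  · rw [pow_add, ← zpow_natCast, ← zpow_natCast, h.mul_zpow_le_iff]
    exact hgb.trans hm

theorem exists_eq_succ_of_antitone (h : IsGarsideOrder Δ) {f : ℕ → G}
    (hf : ∀ k, f (k + 1) ≤ f k) {a : G} (ha : ∀ k, a ≤ f k) : ∃ k, f (k + 1) = f k := by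
  have hanti : Antitone f := antitone_nat_of_succ_le hf
  obtain ⟨i, j, hij, he⟩ := Set.Finite.exists_lt_map_eq_of_forall_mem
    (f := f) (t := Set.Icc a (f 0)) (fun k => ⟨ha k, hanti (Nat.zero_le k)⟩)
    (h.finite_Icc_all _ _)
  exact ⟨i, le_antisymm (hf i) (he.le.trans (hanti hij))⟩

theorem exists_eq_succ_of_monotone (h : IsGarsideOrder Δ) {f : ℕ → G}
    (hf : ∀ k, f k ≤ f (k + 1)) {b : G} (hb : ∀ k, f k ≤ b) : ∃ k, f (k + 1) = f k := by
  have hmono : Monotone f := monotone_nat_of_le_succ hf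
  obtain ⟨i, j, hij, he⟩ := Set.Finite.exists_lt_map_eq_of_forall_mem
    (f := f) (t := Set.Icc (f 0) b) (fun k => ⟨hmono (Nat.zero_le k), hb k⟩)
    (h.finite_Icc_all _ _)
  exact ⟨i, le_antisymm ((hmono hij).trans he.ge) (hf i)⟩

end Basic

end IsGarsideOrder

/-! ### Infimum, sliding prefix and sliding in a Garside order -/

section Sliding

variable {G : Type u} [Group G] [SemilatticeInf G] (Δ : G)

/-- The greatest integer `p` with `Δ ^ p ≤ x`. -/
noncomputable def infimum (x : G) : ℤ := sSup {p : ℤ | Δ ^ p ≤ x}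

/-- The sliding prefix, in a form symmetric in `x` and `x⁻¹`. -/
noncomputable def pre (x : G) : G :=
  Δ ⊓ x * Δ ^ (-infimum Δ x) ⊓ x⁻¹ * Δ ^ (-infimum Δ x⁻¹)

/-- Conjugation by the sliding prefix. -/
noncomputable def slide (x : G) : G := (pre Δ x)⁻¹ * x * pre Δ x

/-- The map on conjugators which induces the sliding of the conjugates `s⁻¹ x s`
with infimum `p` and whose inverse has infimum `r`. -/
def transport (x : G) (p r : ℤ) (s : G) : G :=
  s * Δ ⊓ x * s * Δ ^ (-p) ⊓ x⁻¹ * s * Δ ^ (-r)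

/-- The infima of `x` and `x⁻¹` stay equal to `p` and `r` under iterated sliding. -/
def IsStable (x : G) (p r : ℤ) : Prop :=
  ∀ k : ℕ, infimum Δ ((slide Δ)^[k] x) = p ∧ infimum Δ ((slide Δ)^[k] x)⁻¹ = r

end Sliding

namespace IsGarsideOrder

variable {G : Type u} [Group G] [SemilatticeInf G] {Δ : G}

theorem le_infimum_iff (h : IsGarsideOrder Δ) {x : G} {p : ℤ} :
    p ≤ infimum Δ x ↔ Δ ^ p ≤ x := by
  obtain ⟨n, hn1, hn2⟩ := h.exists_zpow_bounds x
  have hb : BddAbove {p : ℤ | Δ ^ p ≤ x} := ⟨n, fun q hq => h.zpow_le_iff.1 (le_trans hq hn2)⟩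
  have hm : infimum Δ x ∈ {p : ℤ | Δ ^ p ≤ x} := Int.csSup_mem ⟨-n, hn1⟩ hb
  exact ⟨fun H => (h.zpow_mono H).trans hm, fun H => le_csSup hb H⟩

theorem zpow_infimum_le (h : IsGarsideOrder Δ) (x : G) : Δ ^ infimum Δ x ≤ x :=
  h.le_infimum_iff.1 le_rfl

/-- The supremum of `x` is thus `-infimum Δ x⁻¹`, so no separate notion is needed. -/
theorem le_infimum_inv_iff (h : IsGarsideOrder Δ) {x : G} {p : ℤ} :
    p ≤ infimum Δ x⁻¹ ↔ x ≤ Δ ^ (-p) := by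
  rw [h.le_infimum_iff, ← h.mul_le_mul_left_iff (a := x), mul_inv_cancel,
    ← one_mul (Δ ^ (-p)), h.le_mul_zpow_iff, neg_neg]

theorem le_zpow_infimum_inv (h : IsGarsideOrder Δ) (x : G) : x ≤ Δ ^ (-infimum Δ x⁻¹) :=
  h.le_infimum_inv_iff.1 le_rfl

theorem infimum_eq_iff (h : IsGarsideOrder Δ) {x : G} {p : ℤ} :
    infimum Δ x = p ↔ Δ ^ p ≤ x ∧ ¬ Δ ^ (p + 1) ≤ x := by
  rw [← h.le_infimum_iff, ← h.le_infimum_iff]; omega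

theorem infimum_add_le_zero (h : IsGarsideOrder Δ) (x : G) :
    infimum Δ x + infimum Δ x⁻¹ ≤ 0 := by
  have := h.zpow_le_iff.1 ((h.zpow_infimum_le x).trans (h.le_zpow_infimum_inv x))
  omega

theorem le_infimum_conj_iff (h : IsGarsideOrder Δ) {x c : G} {p : ℤ} :
    p ≤ infimum Δ (c⁻¹ * x * c) ↔ c * Δ ^ p ≤ x * c := by
  rw [h.le_infimum_iff, ← h.mul_le_mul_left_iff (a := c)]
  simp [mul_assoc]

theorem le_infimum_conj_inv_iff (h : IsGarsideOrder Δ) {x c : G} {p : ℤ} :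
    p ≤ infimum Δ (c⁻¹ * x * c)⁻¹ ↔ c * Δ ^ p ≤ x⁻¹ * c := by
  rw [inv_conj, h.le_infimum_conj_iff]

theorem pre_inv (x : G) : pre Δ x⁻¹ = pre Δ x := by
  simp only [pre, inv_inv, inf_assoc]
  rw [inf_comm (x * _)]

theorem slide_inv (x : G) : slide Δ x⁻¹ = (slide Δ x)⁻¹ := by
  simp only [slide, pre_inv]; group

theorem slide_iterate_inv (x : G) (k : ℕ) : (slide Δ)^[k] x⁻¹ = ((slide Δ)^[k] x)⁻¹ := by
  induction k with
  | zero => rfl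
  | succ k ih => rw [Function.iterate_succ_apply', ih, slide_inv, Function.iterate_succ_apply']

theorem one_le_mul_zpow_infimum (h : IsGarsideOrder Δ) (x : G) :
    1 ≤ x * Δ ^ (-infimum Δ x) := by
  rw [h.le_mul_zpow_iff, neg_neg, one_mul]; exact h.zpow_infimum_le x

theorem one_le_pre (h : IsGarsideOrder Δ) (x : G) : 1 ≤ pre Δ x :=
  le_inf (le_inf h.one_lt.le (h.one_le_mul_zpow_infimum x)) (h.one_le_mul_zpow_infimum x⁻¹)

theorem pre_le (x : G) : pre Δ x ≤ Δ := inf_le_left.trans inf_le_left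

theorem infimum_le_infimum_slide (h : IsGarsideOrder Δ) (x : G) :
    infimum Δ x ≤ infimum Δ (slide Δ x) := by
  rw [slide, h.le_infimum_conj_iff]
  calc pre Δ x * Δ ^ infimum Δ x ≤ x := by
        have := h.le_mul_zpow_iff (-infimum Δ x) (a := pre Δ x) (b := x)
        rw [neg_neg] at this
        exact this.1 (inf_le_left.trans inf_le_right)
    _ = x * 1 := (mul_one x).symm
    _ ≤ x * pre Δ x := h.mul_left_le _ _ _ (h.one_le_pre x)

theorem infimum_inv_le_infimum_inv_slide (h : IsGarsideOrder Δ) (x : G) :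
    infimum Δ x⁻¹ ≤ infimum Δ (slide Δ x)⁻¹ := by
  rw [← slide_inv]; exact h.infimum_le_infimum_slide x⁻¹

theorem infimum_iterate_mono (h : IsGarsideOrder Δ) (x : G) :
    Monotone fun k => infimum Δ ((slide Δ)^[k] x) :=
  monotone_nat_of_le_succ fun k => by
    rw [Function.iterate_succ_apply']; exact h.infimum_le_infimum_slide _

theorem infimum_inv_iterate_mono (h : IsGarsideOrder Δ) (x : G) :
    Monotone fun k => infimum Δ ((slide Δ)^[k] x)⁻¹ :=
  monotone_nat_of_le_succ fun k => by
    rw [Function.iterate_succ_apply']; exact h.infimum_inv_le_infimum_inv_slide _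

/-- Since neither infimum ever decreases, the whole orbit stays in one finite interval. -/
theorem exists_iterate_eq_iterate (h : IsGarsideOrder Δ) (x : G) :
    ∃ i j, i < j ∧ (slide Δ)^[i] x = (slide Δ)^[j] x :=
  Set.Finite.exists_lt_map_eq_of_forall_mem
    (f := fun k => (slide Δ)^[k] x)
    (t := Set.Icc (Δ ^ infimum Δ x) (Δ ^ (-infimum Δ x⁻¹)))
    (fun k => ⟨h.le_infimum_iff.1 (h.infimum_iterate_mono x (Nat.zero_le k)),
      h.le_infimum_inv_iff.1 (h.infimum_inv_iterate_mono x (Nat.zero_le k))⟩)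
    (h.finite_Icc_all _ _)

theorem isConj_slide (x : G) : IsConj x (slide Δ x) :=
  isConj_iff.2 ⟨(pre Δ x)⁻¹, by simp [slide]⟩

theorem isConj_slide_iterate (x : G) (k : ℕ) : IsConj x ((slide Δ)^[k] x) := by
  induction k with
  | zero => exact IsConj.refl x
  | succ k ih => rw [Function.iterate_succ_apply']; exact ih.trans (isConj_slide _)

/-! #### Transport of conjugators -/

theorem transport_inf (h : IsGarsideOrder Δ) (x : G) (p r : ℤ) (s t : G) :
    transport Δ x p r (s ⊓ t) = transport Δ x p r s ⊓ transport Δ x p r t := by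
  have h1 : (s ⊓ t) * Δ = s * Δ ⊓ t * Δ := by simpa using h.inf_mul_zpow 1 s t
  simp only [transport, h.mul_inf_eq, h.inf_mul_zpow, h1]
  ac_rfl

theorem transport_iterate_inf (h : IsGarsideOrder Δ) (x : G) (p r : ℤ) (s t : G) (k : ℕ) :
    (transport Δ x p r)^[k] (s ⊓ t) =
      (transport Δ x p r)^[k] s ⊓ (transport Δ x p r)^[k] t := by
  induction k with
  | zero => rfl
  | succ k ih => simp only [Function.iterate_succ_apply', ih, h.transport_inf]

theorem transport_mono (h : IsGarsideOrder Δ) (x : G) (p r : ℤ) :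
    Monotone (transport Δ x p r) := fun s t hst => by
  rw [← inf_eq_left, ← h.transport_inf, inf_eq_left.2 hst]

theorem transport_mul_left (h : IsGarsideOrder Δ) {x z : G} (hz : Commute z x) (p r : ℤ)
    (s : G) : transport Δ x p r (z * s) = z * transport Δ x p r s := by
  simp only [transport, h.mul_inf_eq, ← mul_assoc, hz.eq, hz.inv_right.eq]

theorem transport_iterate_mul_left (h : IsGarsideOrder Δ) {x z : G} (hz : Commute z x)
    (p r : ℤ) (s : G) (k : ℕ) :
    (transport Δ x p r)^[k] (z * s) = z * (transport Δ x p r)^[k] s := by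
  induction k with
  | zero => rfl
  | succ k ih => simp only [Function.iterate_succ_apply', ih, h.transport_mul_left hz]

theorem transport_mul_zpow (h : IsGarsideOrder Δ) (x : G) (p r z : ℤ) (s : G) :
    transport Δ x p r (s * Δ ^ z) = transport Δ x p r s * Δ ^ z := by
  simp only [transport, h.inf_mul_zpow, mul_assoc, ← zpow_add]
  rw [(Commute.zpow_self Δ z).eq, add_comm z, add_comm z]

theorem transport_iterate_mul_zpow (h : IsGarsideOrder Δ) (x : G) (p r z : ℤ) (s : G) (k : ℕ) :
    (transport Δ x p r)^[k] (s * Δ ^ z) = (transport Δ x p r)^[k] s * Δ ^ z := by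
  induction k with
  | zero => rfl
  | succ k ih => simp only [Function.iterate_succ_apply', ih, h.transport_mul_zpow]

theorem transport_eq_mul_pre (h : IsGarsideOrder Δ) {x s : G} {p r : ℤ}
    (hp : infimum Δ (s⁻¹ * x * s) = p) (hr : infimum Δ (s⁻¹ * x * s)⁻¹ = r) :
    transport Δ x p r s = s * pre Δ (s⁻¹ * x * s) := by
  rw [pre, hp, hr, inv_conj, h.mul_inf_eq, h.mul_inf_eq, transport]
  simp only [← mul_assoc, mul_inv_cancel, one_mul]

theorem slide_iterate_conj (h : IsGarsideOrder Δ) {x s : G} {p r : ℤ}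
    (hs : IsStable Δ (s⁻¹ * x * s) p r) (k : ℕ) :
    (slide Δ)^[k] (s⁻¹ * x * s) =
      ((transport Δ x p r)^[k] s)⁻¹ * x * (transport Δ x p r)^[k] s := by
  induction k with
  | zero => rfl
  | succ k ih =>
    obtain ⟨hp, hr⟩ := hs k
    rw [ih] at hp hr
    rw [Function.iterate_succ_apply', Function.iterate_succ_apply', ih,
      h.transport_eq_mul_pre hp hr, slide]
    group

theorem slide_iterate_eq (h : IsGarsideOrder Δ) {x : G} {p r : ℤ}
    (hs : IsStable Δ x p r) (k : ℕ) :
    (slide Δ)^[k] x =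
      ((transport Δ x p r)^[k] 1)⁻¹ * x * (transport Δ x p r)^[k] 1 := by
  have := h.slide_iterate_conj (x := x) (s := 1) (p := p) (r := r) (by simpa using hs) k
  simpa using this

theorem transport_iterate_succ_one (h : IsGarsideOrder Δ) {x : G} {p r : ℤ}
    (hs : IsStable Δ x p r) (k : ℕ) :
    (transport Δ x p r)^[k + 1] 1 =
      (transport Δ x p r)^[k] 1 * pre Δ ((slide Δ)^[k] x) := by
  obtain ⟨hp, hr⟩ := hs k
  rw [h.slide_iterate_eq hs] at hp hr ⊢
  rw [Function.iterate_succ_apply', h.transport_eq_mul_pre hp hr]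

/-! #### Elements with stable infimum under sliding have maximal infimum -/

theorem exists_one_le_or_le_one (h : IsGarsideOrder Δ) (u : G) :
    ∃ n : ℕ, 1 ≤ u * Δ ^ (n : ℤ) ∧ u * Δ ^ (-(n : ℤ)) ≤ 1 := by
  obtain ⟨n, h1, h2⟩ := h.exists_zpow_bounds u
  refine ⟨n, ?_, ?_⟩
  · rwa [h.le_mul_zpow_iff, one_mul]
  · rwa [← h.le_mul_zpow_iff, one_mul]

/-- Case of canonical length at least 2. A conjugator `u` to infimum `p + 1` bounds a decreasing
sequence from below; once that sequence stabilizes, iterated sliding itself has reached infimum `p +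
1`. -/
theorem not_le_of_isStable_of_add_le (h : IsGarsideOrder Δ) {x : G} {p r : ℤ}
    (hs : IsStable Δ x p r) (hpr : p + r ≤ -2) (u : G) : ¬ u * Δ ^ (p + 1) ≤ x * u := by
  intro hu
  -- Right multiplication of `u` by a power of `Δ` preserves the inequality, so `u` may be pushed
  -- below 1.
  wlog hu1 : u ≤ 1 generalizing u
  · obtain ⟨n, -, hn⟩ := h.exists_one_le_or_le_one u
    refine this _ ?_ hn
    rw [mul_assoc, ← zpow_add, add_comm, zpow_add, ← mul_assoc, ← mul_assoc, h.mul_zpow_le_iff]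
    exact hu
  set g : G → G := fun s => s ⊓ x * s * Δ ^ (-p - 1) with hg
  -- Up to the factor `Δ`, `f` is `transport`. Dropping the term with `x⁻¹` gives `g`, whose fixed
  -- points `s` are exactly the solutions of `s Δ^(p+1) ≤ x s`.
  set f : G → G := fun s => s ⊓ x * s * Δ ^ (-p - 1) ⊓ x⁻¹ * s * Δ ^ (-r - 1) with hf
  have gmono : Monotone g := fun a b hab =>
    inf_le_inf hab ((h.mul_zpow_le_iff _).2 (h.mul_left_le _ _ _ hab))
  have ug : u ≤ g u := le_inf le_rfl (by
    rw [h.le_mul_zpow_iff]; convert! hu using 3; ring)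
  obtain ⟨k, hk⟩ := h.exists_eq_succ_of_antitone (f := fun k => g^[k] 1) (a := u)
    (fun k => by rw [Function.iterate_succ_apply']; exact inf_le_left)
    (fun k => by
      induction k with
      | zero => exact hu1
      | succ k ih => rw [Function.iterate_succ_apply']; exact ug.trans (gmono ih))
  have hfg : ∀ k, f^[k] 1 ≤ g^[k] 1 := fun k => by
    induction k with
    | zero => exact le_rfl
    | succ k ih =>
      rw [Function.iterate_succ_apply', Function.iterate_succ_apply']
      exact (inf_le_left : f (f^[k] 1) ≤ g (f^[k] 1)).trans (gmono ih)
  -- The bound that carries the stabilization of `g` over to `f`. Applying `x · Δ^(-p-1)` to the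
  -- term of `f` with `x⁻¹` gives a factor `Δ^(-p-r-2)`, which is at least 1 because `p + r ≤ -2`.
  have key : ∀ k, g^[k + 1] 1 ⊓ f^[k] 1 ≤ x * f^[k] 1 * Δ ^ (-p - 1) := fun k => by
    induction k with
    | zero => exact inf_le_left.trans inf_le_right
    | succ k ih =>
      have e : x * f^[k + 1] 1 * Δ ^ (-p - 1) = x * f^[k] 1 * Δ ^ (-p - 1) ⊓
          x * (x * f^[k] 1 * Δ ^ (-p - 1)) * Δ ^ (-p - 1) ⊓ f^[k] 1 * Δ ^ (-p - r - 2) := by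
        rw [Function.iterate_succ_apply']
        simp only [hf, h.mul_inf_eq, h.inf_mul_zpow]
        congr 1
        rw [← mul_assoc, mul_inv_cancel_left, mul_assoc, ← zpow_add]
        congr 2; ring
      have hk1 : f^[k + 1] 1 = f (f^[k] 1) := Function.iterate_succ_apply' _ _ _
      have le1 : f^[k + 1] 1 ≤ x * f^[k] 1 * Δ ^ (-p - 1) := by
        rw [hk1]; exact inf_le_left.trans inf_le_right
      have le0 : f^[k + 1] 1 ≤ f^[k] 1 := by
        rw [hk1]; exact inf_le_left.trans inf_le_left
      rw [e]
      refine le_inf (le_inf (inf_le_right.trans le1) ?_) (inf_le_right.trans ?_)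
      · refine le_trans ?_ ((h.mul_zpow_le_iff _).2 (h.mul_left_le x _ _ ih))
        rw [h.mul_inf_eq, h.inf_mul_zpow]
        refine inf_le_inf ?_ le1
        rw [Function.iterate_succ_apply' g (k + 1)]
        exact inf_le_right
      · refine le0.trans ?_
        rw [h.le_mul_zpow_iff]
        have := h.zpow_mono (show -(-p - r - 2) ≤ 0 by omega)
        simpa using h.mul_left_le (f^[k] 1) _ _ this
  have hft : ∀ k : ℕ, (transport Δ x p r)^[k] 1 = f^[k] 1 * Δ ^ (k : ℤ) := fun k => by
    induction k with
    | zero => simp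
    | succ k ih =>
      rw [Function.iterate_succ_apply', ih, h.transport_mul_zpow, Function.iterate_succ_apply',
        Nat.cast_succ, add_comm, zpow_add, ← mul_assoc]
      congr 1
      simp only [hf, h.inf_mul_zpow, transport, mul_assoc, ← zpow_add]
      simp
  have hC : f^[k] 1 ≤ x * f^[k] 1 * Δ ^ (-p - 1) := by
    have := key k
    rwa [show g^[k + 1] 1 = g^[k] 1 from hk, inf_eq_right.2 (hfg k)] at this
  have hinf := (hs k).1
  have : p + 1 ≤ infimum Δ ((slide Δ)^[k] x) := by
    rw [h.slide_iterate_eq hs, h.le_infimum_conj_iff, hft, mul_assoc, ← zpow_add, add_comm,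
      zpow_add, ← mul_assoc, ← mul_assoc, h.mul_zpow_le_iff]
    rw [h.le_mul_zpow_iff] at hC
    convert! hC using 3; ring
  omega

/-- The infimum of the `j`-th power of the conjugate is at least `j(p+1)`, and undoing the
conjugation by `u` costs at most `2n` if `Δ^(-n) ≤ u ≤ Δ^n`. So `j = 2n + 1` gains one `Δ` over `j
p`. -/
theorem exists_le_pow_mul_of_conj (h : IsGarsideOrder Δ) {x u : G} {p : ℤ}
    (hu : u * Δ ^ (p + 1) ≤ x * u) : ∃ j : ℕ, Δ ≤ x ^ (j + 1) * Δ ^ (-((j + 1 : ℕ) * p : ℤ)) := by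
  obtain ⟨n, hn1, hn2⟩ := h.exists_zpow_bounds u
  have key : ∀ j : ℕ, u * Δ ^ (j * (p + 1) : ℤ) ≤ x ^ j * u := fun j => by
    induction j with
    | zero => simp
    | succ j ih =>
      calc u * Δ ^ ((j + 1 : ℕ) * (p + 1) : ℤ)
          = u * Δ ^ (p + 1) * Δ ^ (j * (p + 1) : ℤ) := by
            rw [mul_assoc, ← zpow_add]; congr 2; push_cast; ring
        _ ≤ x * u * Δ ^ (j * (p + 1) : ℤ) := (h.mul_zpow_le_iff _).2 hu
        _ ≤ x ^ (j + 1) * u := by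
            rw [pow_succ', mul_assoc, mul_assoc]; exact h.mul_left_le _ _ _ ih
  refine ⟨2 * n, ?_⟩
  set j := 2 * n + 1 with hj
  have h1 : Δ ^ (-(n : ℤ)) * Δ ^ (j * (p + 1) : ℤ) ≤ x ^ j * Δ ^ (n : ℤ) :=
    ((h.mul_zpow_le_iff _).2 hn1).trans ((key j).trans (h.mul_left_le _ _ _ hn2))
  rw [h.le_mul_zpow_iff, ← zpow_add, ← zpow_add] at h1
  rw [h.le_mul_zpow_iff]
  convert! h1 using 1
  rw [← zpow_one_add]
  congr 1
  rw [hj]; push_cast; ring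

/-- The hypothesis `hpre` says that consecutive factors of the powers of `y` are left-weighted, so
the simple head of such a power is no larger than the first factor. -/
theorem inf_pow_le (h : IsGarsideOrder Δ) {y : G} {p : ℤ} (hp : Δ ^ p ≤ y)
    (hpre : y * Δ ^ (-p) ⊓ y⁻¹ * Δ ^ (p + 1) ≤ 1) (j : ℕ) :
    Δ ⊓ y ^ (j + 1) * Δ ^ (-((j + 1 : ℕ) * p : ℤ)) ≤ y * Δ ^ (-p) := by
  induction j with
  | zero => simp
  | succ j ih =>
    have h1 : Δ ≤ y * Δ ^ (-p) * Δ := by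
      have : (1 : G) ≤ y * Δ ^ (-p) := by rwa [h.le_mul_zpow_iff, neg_neg, one_mul]
      simpa using (h.mul_right_le _ _).2 this
    have h2 : y ^ (j + 1 + 1) * Δ ^ (-((j + 1 + 1 : ℕ) * p : ℤ)) =
        y * (y ^ (j + 1) * Δ ^ (-((j + 1 : ℕ) * p : ℤ))) * Δ ^ (-p) := by
      rw [pow_succ', mul_assoc, mul_assoc, mul_assoc, ← zpow_add]
      congr 3; push_cast; ring
    have h3 : y * Δ ^ (-p) * Δ = y * Δ * Δ ^ (-p) := by
      rw [mul_assoc, mul_assoc, ((Commute.refl Δ).zpow_right (-p)).eq]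
    have h4 : Δ ⊓ y * (y * Δ ^ (-p)) * Δ ^ (-p) ≤ y * Δ ^ (-p) := by
      calc Δ ⊓ y * (y * Δ ^ (-p)) * Δ ^ (-p)
          = y * (y * Δ ^ (-p) ⊓ y⁻¹ * Δ ^ (p + 1)) * Δ ^ (-p) := by
            rw [h.mul_inf_eq, h.inf_mul_zpow, mul_inv_cancel_left, ← zpow_add, inf_comm]
            simp
        _ ≤ y * 1 * Δ ^ (-p) := (h.mul_zpow_le_iff _).2 (h.mul_left_le _ _ _ hpre)
        _ = y * Δ ^ (-p) := by rw [mul_one]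
    refine le_trans (le_inf inf_le_left ?_) h4
    rw [h2]
    refine (inf_le_inf_right _ h1).trans ?_
    rw [h3, ← h.inf_mul_zpow, h.mul_zpow_le_iff, ← h.mul_inf_eq]
    exact h.mul_left_le _ _ _ ih

theorem not_le_of_isStable (h : IsGarsideOrder Δ) {x : G} {p r : ℤ}
    (hs : IsStable Δ x p r) (u : G) : ¬ u * Δ ^ (p + 1) ≤ x * u := by
  intro hu
  by_cases hpr : p + r ≤ -2
  · exact h.not_le_of_isStable_of_add_le hs hpr u hu
  have h0 : p + r ≤ 0 := by
    have := h.infimum_add_le_zero x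
    rwa [show infimum Δ x = p from (hs 0).1, show infimum Δ x⁻¹ = r from (hs 0).2] at this
  obtain hr | hr : r = -p ∨ r = -(p + 1) := by omega
  -- Canonical length 0: the infimum of a conjugate of `Δ^p` cannot exceed `p`, as its powers would
  -- show.
  · have hx : x = Δ ^ p := by
      apply le_antisymm
      · have := h.le_zpow_infimum_inv x
        rwa [show infimum Δ x⁻¹ = r from (hs 0).2, hr, neg_neg] at this
      · have := h.zpow_infimum_le x
        rwa [show infimum Δ x = p from (hs 0).1] at this
    obtain ⟨j, hj⟩ := h.exists_le_pow_mul_of_conj hu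
    rw [hx, ← zpow_natCast, ← zpow_mul, ← zpow_add] at hj
    have : Δ ^ (1 : ℤ) ≤ Δ ^ (0 : ℤ) := by
      rw [zpow_one]; convert! hj using 2; ring
    have := h.zpow_le_iff.1 this
    omega
  · wlog hu1 : 1 ≤ u generalizing u
    · obtain ⟨n, hn, -⟩ := h.exists_one_le_or_le_one u
      refine this _ ?_ hn
      rw [mul_assoc, ← zpow_add, add_comm, zpow_add, ← mul_assoc, ← mul_assoc, h.mul_zpow_le_iff]
      exact hu
    -- Canonical length 1. Here `u` is an upper bound of the increasing sequence `F^k 1`; where that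
    -- sequence stops, the sliding prefix is trivial and the powers of the element reached are
    -- left-weighted.
    have hFu : transport Δ x p r u ≤ u := by
      refine inf_le_right.trans ?_
      rw [← h.mul_le_mul_left_iff (a := x), mul_assoc, mul_inv_cancel_left, hr, neg_neg]
      exact hu
    obtain ⟨k, hk⟩ := h.exists_eq_succ_of_monotone (f := fun k => (transport Δ x p r)^[k] 1)
      (b := u)
      (fun k => by
        rw [h.transport_iterate_succ_one hs]
        simpa using h.mul_left_le ((transport Δ x p r)^[k] 1) _ _ (h.one_le_pre _))
      (fun k => by
        induction k with
        | zero => exact hu1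
        | succ k ih =>
          rw [Function.iterate_succ_apply']
          exact (h.transport_mono x p r ih).trans hFu)
    simp only [h.transport_iterate_succ_one hs, mul_eq_left] at hk
    set y := (slide Δ)^[k] x with hy
    obtain ⟨hyp, hyr⟩ := hs k
    rw [← hy] at hyp hyr
    set c := (transport Δ x p r)^[k] 1 with hc
    have hyc : y = c⁻¹ * x * c := h.slide_iterate_eq hs k
    have hyu : (c⁻¹ * u) * Δ ^ (p + 1) ≤ y * (c⁻¹ * u) := by
      rw [hyc, ← h.mul_le_mul_left_iff (a := c)]
      simpa [mul_assoc] using hu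
    obtain ⟨j, hj⟩ := h.exists_le_pow_mul_of_conj hyu
    have hpy : Δ ^ p ≤ y := hyp ▸ h.zpow_infimum_le y
    have hle : y * Δ ^ (-p) ≤ Δ := by
      have := h.le_zpow_infimum_inv y
      rw [hyr, hr, neg_neg, add_comm, zpow_add, zpow_one] at this
      rw [← h.mul_zpow_le_iff p]
      simpa using this
    have hpre : y * Δ ^ (-p) ⊓ y⁻¹ * Δ ^ (p + 1) ≤ 1 := by
      rw [pre, hyp, hyr, inf_eq_right.2 hle, hr, neg_neg] at hk
      exact hk.le
    have := (le_inf le_rfl hj).trans (h.inf_pow_le hpy hpre j)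
    have h5 : p + 1 ≤ infimum Δ y := by
      rw [h.le_infimum_iff, add_comm, zpow_add, zpow_one]
      rw [h.le_mul_zpow_iff, neg_neg] at this
      exact this
    omega

end IsGarsideOrder

end Garside

namespace Garside

namespace IsGarsideOrder

open Function

variable {G : Type u} [Group G] [SemilatticeInf G] {Δ : G}

/-! #### Periodic points of the sliding -/

theorem isStable_of_mem_periodicPts (h : IsGarsideOrder Δ) {x : G}
    (hx : x ∈ periodicPts (slide Δ)) : IsStable Δ x (infimum Δ x) (infimum Δ x⁻¹) := by
  obtain ⟨m, hm, hper⟩ := hx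
  intro k
  have hk : (slide Δ)^[m * k] x = x := (hper.mul_const k : IsPeriodicPt (slide Δ) (m * k) x)
  have hle : k ≤ m * k := Nat.le_mul_of_pos_left k hm
  have h1 := h.infimum_iterate_mono x (Nat.zero_le k)
  have h2 := h.infimum_iterate_mono x hle
  have h3 := h.infimum_inv_iterate_mono x (Nat.zero_le k)
  have h4 := h.infimum_inv_iterate_mono x hle
  simp only [hk, iterate_zero, id] at h1 h2 h3 h4
  exact ⟨le_antisymm h2 h1, le_antisymm h4 h3⟩

theorem isStable_inv {x : G} {p r : ℤ} (hs : IsStable Δ x p r) : IsStable Δ x⁻¹ r p := fun k => by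
  rw [slide_iterate_inv, inv_inv]; exact (hs k).symm

theorem infimum_conj_le (h : IsGarsideOrder Δ) {x : G} (hx : x ∈ periodicPts (slide Δ)) (c : G) :
    infimum Δ (c⁻¹ * x * c) ≤ infimum Δ x := by
  by_contra! hlt
  exact h.not_le_of_isStable (h.isStable_of_mem_periodicPts hx) c (h.le_infimum_conj_iff.1 hlt)

theorem infimum_conj_inv_le (h : IsGarsideOrder Δ) {x : G} (hx : x ∈ periodicPts (slide Δ))
    (c : G) : infimum Δ (c⁻¹ * x * c)⁻¹ ≤ infimum Δ x⁻¹ := by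
  by_contra! hlt
  exact h.not_le_of_isStable (isStable_inv (h.isStable_of_mem_periodicPts hx)) c
    (h.le_infimum_conj_inv_iff.1 hlt)

theorem exists_iterate_eq_conj (x : G) (k : ℕ) : ∃ c, (slide Δ)^[k] x = c⁻¹ * x * c := by
  obtain ⟨c, hc⟩ := isConj_iff.1 (isConj_slide_iterate (Δ := Δ) x k)
  exact ⟨c⁻¹, by simpa using hc.symm⟩

theorem isStable_conj (h : IsGarsideOrder Δ) {x s : G} (hx : x ∈ periodicPts (slide Δ))
    (hp : s * Δ ^ infimum Δ x ≤ x * s) (hr : s * Δ ^ infimum Δ x⁻¹ ≤ x⁻¹ * s) :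
    IsStable Δ (s⁻¹ * x * s) (infimum Δ x) (infimum Δ x⁻¹) := fun k => by
  have h1 := h.infimum_iterate_mono (s⁻¹ * x * s) (Nat.zero_le k)
  have h2 := h.infimum_inv_iterate_mono (s⁻¹ * x * s) (Nat.zero_le k)
  obtain ⟨c, hc⟩ := exists_iterate_eq_conj (Δ := Δ) (s⁻¹ * x * s) k
  have hc' : (slide Δ)^[k] (s⁻¹ * x * s) = (s * c)⁻¹ * x * (s * c) := by rw [hc]; group
  have h3 := h.infimum_conj_le hx (s * c)
  have h4 := h.infimum_conj_inv_le hx (s * c)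
  rw [← hc'] at h3 h4
  exact ⟨le_antisymm h3 ((h.le_infimum_conj_iff.2 hp).trans h1),
    le_antisymm h4 ((h.le_infimum_conj_inv_iff.2 hr).trans h2)⟩

theorem infimum_eq_of_conj (h : IsGarsideOrder Δ) {x s : G} (hx : x ∈ periodicPts (slide Δ))
    (hs : s⁻¹ * x * s ∈ periodicPts (slide Δ)) :
    infimum Δ (s⁻¹ * x * s) = infimum Δ x ∧ infimum Δ (s⁻¹ * x * s)⁻¹ = infimum Δ x⁻¹ := by
  have e : x = s⁻¹⁻¹ * (s⁻¹ * x * s) * s⁻¹ := by group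
  have h1 := h.infimum_conj_le hs s⁻¹
  have h2 := h.infimum_conj_inv_le hs s⁻¹
  rw [← e] at h1 h2
  exact ⟨le_antisymm (h.infimum_conj_le hx s) h1, le_antisymm (h.infimum_conj_inv_le hx s) h2⟩

/-- As `z` centralizes `x`, conjugating `x` by `z * s` or by `s` gives the same element. -/
theorem mem_periodicPts_conj (h : IsGarsideOrder Δ) {x s z : G} {N : ℕ}
    (hx : x ∈ periodicPts (slide Δ))
    (hp : s * Δ ^ infimum Δ x ≤ x * s) (hr : s * Δ ^ infimum Δ x⁻¹ ≤ x⁻¹ * s)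
    (hN : 0 < N) (hz : Commute z x)
    (hF : (transport Δ x (infimum Δ x) (infimum Δ x⁻¹))^[N] s = z * s) :
    s⁻¹ * x * s ∈ periodicPts (slide Δ) := by
  refine ⟨N, hN, ?_⟩
  rw [IsPeriodicPt, IsFixedPt, h.slide_iterate_conj (h.isStable_conj hx hp hr), hF]
  calc (z * s)⁻¹ * x * (z * s) = s⁻¹ * z⁻¹ * (x * z) * s := by group
    _ = s⁻¹ * x * s := by rw [← hz.eq]; group

theorem transport_iterate_mul (h : IsGarsideOrder Δ) {x s z : G} {p r : ℤ} {N : ℕ}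
    (hz : Commute z x) (hF : (transport Δ x p r)^[N] s = z * s) (j : ℕ) :
    (transport Δ x p r)^[j * N] s = z ^ j * s := by
  induction j with
  | zero => simp
  | succ j ih =>
    rw [Nat.succ_mul, Nat.add_comm, iterate_add_apply, ih,
      h.transport_iterate_mul_left (hz.pow_left j), hF, pow_succ, mul_assoc]

/-- After a common period, `F` multiplies 1 and `s` on the left by elements `v` and `w` of the
centralizer. Monotonicity keeps `v^(-j) w^j s` within fixed powers of `Δ`, so finiteness forces
`v^(d+1) = w^(d+1)` for some `d`. Having the same `z` for `s` and for 1 is what later allows two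
conjugators to be compared. -/
theorem exists_transport_iterate_eq (h : IsGarsideOrder Δ) {x s : G}
    (hx : x ∈ periodicPts (slide Δ)) (hs : s⁻¹ * x * s ∈ periodicPts (slide Δ)) :
    ∃ N z, 0 < N ∧ Commute z x ∧
      (transport Δ x (infimum Δ x) (infimum Δ x⁻¹))^[N] s = z * s ∧
      (transport Δ x (infimum Δ x) (infimum Δ x⁻¹))^[N] 1 = z * 1 := by
  have hst := h.isStable_of_mem_periodicPts hx
  have hst' := h.isStable_of_mem_periodicPts hs
  rw [(h.infimum_eq_of_conj hx hs).1, (h.infimum_eq_of_conj hx hs).2] at hst'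
  set F := transport Δ x (infimum Δ x) (infimum Δ x⁻¹) with hF
  obtain ⟨a, ha, hxa⟩ := hx
  obtain ⟨b, hb, hsb⟩ := hs
  have comm : ∀ t : G, (F^[a * b] t)⁻¹ * x * F^[a * b] t = t⁻¹ * x * t →
      Commute (F^[a * b] t * t⁻¹) x := fun t ht => by
    have : F^[a * b] t * t⁻¹ * x = F^[a * b] t * (t⁻¹ * x * t) * t⁻¹ := by group
    rw [Commute, SemiconjBy, this, ← ht]; group
  have c1 := comm 1 (by
    rw [← h.slide_iterate_eq hst]; simpa using! hxa.mul_const b)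
  have cs := comm s (by
    rw [← h.slide_iterate_conj hst']; exact hsb.const_mul a)
  set w := F^[a * b] s * s⁻¹ with hw
  set v := F^[a * b] 1 * 1⁻¹ with hv
  have e1 : ∀ j, F^[j * (a * b)] 1 = v ^ j * 1 := fun j =>
    h.transport_iterate_mul c1 (by rw [hv, hF]; simp) j
  have es : ∀ j, F^[j * (a * b)] s = w ^ j * s := fun j =>
    h.transport_iterate_mul cs (by rw [hw, hF]; simp) j
  obtain ⟨n, hn1, hn2⟩ := h.exists_zpow_bounds s
  have hFm : ∀ k, Monotone F^[k] := fun k => (h.transport_mono x _ _).iterate k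
  obtain ⟨i, j, hij, he⟩ := Set.Finite.exists_lt_map_eq_of_forall_mem
    (f := fun j => (v ^ j)⁻¹ * (w ^ j * s)) (t := Set.Icc (Δ ^ (-(n : ℤ))) (Δ ^ (n : ℤ)))
    (fun j => by
      have l1 := hFm (j * (a * b)) hn1
      have l2 := hFm (j * (a * b)) hn2
      rw [← one_mul (Δ ^ (-(n : ℤ))), h.transport_iterate_mul_zpow, e1, es, mul_one] at l1
      rw [← one_mul (Δ ^ (n : ℤ)), h.transport_iterate_mul_zpow, e1, es, mul_one] at l2
      exact ⟨by rw [← h.mul_le_mul_left_iff (a := v ^ j), mul_inv_cancel_left]; exact l1,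
        by rw [← h.mul_le_mul_left_iff (a := v ^ j), mul_inv_cancel_left]; exact l2⟩)
    (h.finite_Icc_all _ _)
  obtain ⟨d, rfl⟩ := Nat.exists_eq_add_of_lt hij
  have hvw : v ^ (d + 1) = w ^ (d + 1) := by
    simp only [← mul_assoc, mul_left_inj] at he
    have ev : v ^ (i + d + 1) = v ^ (d + 1) * v ^ i := by rw [← pow_add]; congr 1; omega
    have ew : w ^ (i + d + 1) = w ^ (d + 1) * w ^ i := by rw [← pow_add]; congr 1; omega
    rw [ev, ew, mul_inv_rev, mul_assoc, mul_right_inj, ← mul_assoc, eq_comm, mul_eq_right,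
      inv_mul_eq_one] at he
    exact he
  refine ⟨(d + 1) * (a * b), v ^ (d + 1), by positivity, c1.pow_left _, ?_, e1 _⟩
  rw [hvw]; exact es _

theorem zpow_le_conj_of_mem_periodicPts (h : IsGarsideOrder Δ) {x s : G}
    (hx : x ∈ periodicPts (slide Δ)) (hs : s⁻¹ * x * s ∈ periodicPts (slide Δ)) :
    s * Δ ^ infimum Δ x ≤ x * s ∧ s * Δ ^ infimum Δ x⁻¹ ≤ x⁻¹ * s := by
  obtain ⟨h1, h2⟩ := h.infimum_eq_of_conj hx hs
  exact ⟨h.le_infimum_conj_iff.1 h1.ge, h.le_infimum_conj_inv_iff.1 h2.ge⟩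

/-- The conjugators between periodic points of the sliding are closed under meets. -/
theorem conj_inf_mem_periodicPts (h : IsGarsideOrder Δ) {x s t : G}
    (hx : x ∈ periodicPts (slide Δ)) (hs : s⁻¹ * x * s ∈ periodicPts (slide Δ))
    (ht : t⁻¹ * x * t ∈ periodicPts (slide Δ)) :
    (s ⊓ t)⁻¹ * x * (s ⊓ t) ∈ periodicPts (slide Δ) := by
  obtain ⟨N, z, hN, hz, hzs, hz1⟩ := h.exists_transport_iterate_eq hx hs
  obtain ⟨K, w, hK, hw, hwt, hw1⟩ := h.exists_transport_iterate_eq hx ht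
  have es := h.transport_iterate_mul hz hzs K
  have et := h.transport_iterate_mul hw hwt N
  have e1 := h.transport_iterate_mul hz hz1 K
  have e2 := h.transport_iterate_mul hw hw1 N
  rw [mul_comm N K] at et e2
  -- Both sides are the value of `F^(K N)` at 1, so `s` and `t` get the same multiplier.
  have hzw : w ^ N = z ^ K := by simpa using e2.symm.trans e1
  rw [hzw] at et
  obtain ⟨hs1, hs2⟩ := h.zpow_le_conj_of_mem_periodicPts hx hs
  obtain ⟨ht1, ht2⟩ := h.zpow_le_conj_of_mem_periodicPts hx ht
  refine h.mem_periodicPts_conj (N := K * N) (z := z ^ K) hx ?_ ?_ (by positivity)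
    (hz.pow_left K) ?_
  · rw [h.inf_mul_zpow, h.mul_inf_eq]; exact inf_le_inf hs1 ht1
  · rw [h.inf_mul_zpow, h.mul_inf_eq]; exact inf_le_inf hs2 ht2
  · rw [h.transport_iterate_inf, es, et, h.mul_inf_eq]

theorem conj_zpow_mem_periodicPts (h : IsGarsideOrder Δ) {x : G}
    (hx : x ∈ periodicPts (slide Δ)) (n : ℤ) :
    (Δ ^ n)⁻¹ * x * Δ ^ n ∈ periodicPts (slide Δ) := by
  obtain ⟨N, z, hN, hz, -, hz1⟩ :=
    h.exists_transport_iterate_eq (s := 1) hx (by simpa using hx)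
  have key : ∀ y : G, Δ ^ n * Δ ^ infimum Δ y ≤ y * Δ ^ n := fun y => by
    rw [(Commute.zpow_zpow_self Δ n _).eq, h.mul_zpow_le_iff]; exact h.zpow_infimum_le y
  refine h.mem_periodicPts_conj hx (key x) (key x⁻¹) hN hz ?_
  conv_lhs => rw [← one_mul (Δ ^ n)]
  rw [h.transport_iterate_mul_zpow, hz1, mul_one]

/-- Any two conjugate periodic points of the sliding are linked by a chain of periodic points in
which neighbours are conjugate by simple elements, stated as an induction principle. -/
theorem periodicPts_conj_induction (h : IsGarsideOrder Δ) {Q : G → Prop}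
    (hQ : ∀ y ∈ periodicPts (slide Δ), ∀ a, 1 ≤ a → a ≤ Δ →
      a⁻¹ * y * a ∈ periodicPts (slide Δ) → (Q y ↔ Q (a⁻¹ * y * a)))
    {x c : G} (hx : x ∈ periodicPts (slide Δ)) (hc : c⁻¹ * x * c ∈ periodicPts (slide Δ))
    (hQx : Q x) : Q (c⁻¹ * x * c) := by
  have hpos : ∀ (n : ℕ) (x c : G), 1 ≤ c → c ≤ Δ ^ n → x ∈ periodicPts (slide Δ) →
      c⁻¹ * x * c ∈ periodicPts (slide Δ) → Q x → Q (c⁻¹ * x * c) := by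
    intro n
    induction n with
    | zero =>
      intro x c h1 h2 _ _ hQx
      obtain rfl : c = 1 := le_antisymm (by simpa using h2) h1
      simpa using hQx
    | succ n ih =>
      intro x c h1 h2 hx hc hQx
      have hxΔ : Δ⁻¹ * x * Δ ∈ periodicPts (slide Δ) := by
        simpa using h.conj_zpow_mem_periodicPts hx 1
      have ha := h.conj_inf_mem_periodicPts hx hc hxΔ
      have hQa := (hQ x hx _ (le_inf h1 h.one_lt.le) inf_le_right ha).1 hQx
      -- Splitting off the simple head `c ⊓ Δ` leaves a conjugator below `Δ^n`, and the intermediate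
      -- conjugate is again periodic.
      have e : c⁻¹ * x * c = ((c ⊓ Δ)⁻¹ * c)⁻¹ * ((c ⊓ Δ)⁻¹ * x * (c ⊓ Δ)) * ((c ⊓ Δ)⁻¹ * c) := by
        group
      rw [e] at hc ⊢
      refine ih _ _ ?_ ?_ ha hc hQa
      · rw [← h.mul_le_mul_left_iff (a := c ⊓ Δ), mul_inv_cancel_left, mul_one]
        exact inf_le_left
      · rw [← h.mul_le_mul_left_iff (a := c ⊓ Δ), mul_inv_cancel_left, ← zpow_natCast,
          h.inf_mul_zpow, zpow_natCast, ← pow_succ']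
        refine le_inf ?_ h2
        rw [← h.mul_le_mul_left_iff (a := c⁻¹)]
        simpa using h.one_le_pow n
  obtain ⟨n, hn1, hn2⟩ := h.exists_zpow_bounds c
  -- A general conjugator becomes positive after multiplication by `Δ^n`; the start is moved by
  -- `Δ^(-n)`, following simple edges backwards.
  have hconj : ∀ m : ℕ, Q ((Δ ^ (-(m : ℤ)))⁻¹ * x * Δ ^ (-(m : ℤ))) := fun m => by
    induction m with
    | zero => simpa using hQx
    | succ m ih =>
      have e : (Δ ^ (-(m : ℤ)))⁻¹ * x * Δ ^ (-(m : ℤ)) =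
          Δ⁻¹ * ((Δ ^ (-((m + 1 : ℕ) : ℤ)))⁻¹ * x * Δ ^ (-((m + 1 : ℕ) : ℤ))) * Δ := by
        push_cast; group
      rw [e] at ih
      refine (hQ _ (h.conj_zpow_mem_periodicPts hx _) Δ h.one_lt.le le_rfl ?_).2 ih
      rw [← e]; exact h.conj_zpow_mem_periodicPts hx _
  have e : c⁻¹ * x * c = (Δ ^ (n : ℤ) * c)⁻¹ *
      ((Δ ^ (-(n : ℤ)))⁻¹ * x * Δ ^ (-(n : ℤ))) * (Δ ^ (n : ℤ) * c) := by group
  obtain ⟨m, hm⟩ := h.exists_le_pow (Δ ^ (n : ℤ) * c)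
  rw [e] at hc ⊢
  refine hpos m _ _ ?_ hm (h.conj_zpow_mem_periodicPts hx _) hc (hconj n)
  rw [← h.mul_le_mul_left_iff (a := Δ ^ (-(n : ℤ)))]
  simpa using hn1

theorem exists_mem_periodicPts (h : IsGarsideOrder Δ) (x : G) :
    ∃ y ∈ periodicPts (slide Δ), IsConj y x := by
  obtain ⟨i, j, hij, he⟩ := h.exists_iterate_eq_iterate x
  refine ⟨(slide Δ)^[i] x, ⟨j - i, by omega, ?_⟩, (isConj_slide_iterate x i).symm⟩
  rw [IsPeriodicPt, IsFixedPt, ← iterate_add_apply, Nat.sub_add_cancel hij.le, he]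

/-- All these points share the infimum of `z` and that of `z⁻¹`, hence lie in one interval. -/
theorem finite_periodicPts_conj (h : IsGarsideOrder Δ) (x : G) :
    {y | IsConj y x ∧ y ∈ periodicPts (slide Δ)}.Finite := by
  obtain ⟨z, hz, hzx⟩ := h.exists_mem_periodicPts x
  refine (h.finite_Icc_all (Δ ^ infimum Δ z) (Δ ^ (-infimum Δ z⁻¹))).subset ?_
  rintro y ⟨hyx, hy⟩
  obtain ⟨c, hc⟩ := isConj_iff.1 (hzx.trans hyx.symm)
  have hc' : c⁻¹⁻¹ * z * c⁻¹ = y := by simpa using hc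
  rw [← hc'] at hy
  obtain ⟨h1, h2⟩ := h.infimum_eq_of_conj hz hy
  rw [hc'] at h1 h2
  exact ⟨h.le_infimum_iff.1 h1.ge, h.le_infimum_inv_iff.1 h2.ge⟩

end IsGarsideOrder

end Garside

namespace Garside

/-! ### The group of fractions of a Garside monoid -/

theorem LeftLE.refl {M : Type u} [Monoid M] (α : FracGroup M) : LeftLE α α := ⟨1, by simp⟩

theorem LeftLE.trans {M : Type u} [Monoid M] {α β γ : FracGroup M} :
    LeftLE α β → LeftLE β γ → LeftLE α γ := by
  rintro ⟨a, ha⟩ ⟨b, hb⟩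
  exact ⟨a * b, by rw [map_mul, ← ha, ← hb]; group⟩

theorem leftLE_mul_left_iff {M : Type u} [Monoid M] {α β γ : FracGroup M} :
    LeftLE (α * β) (α * γ) ↔ LeftLE β γ := by
  simp [LeftLE, mul_assoc]

namespace IsGarsideMonoid

variable {M : Type u} [Monoid M]

theorem mul_left_cancel (hM : IsGarsideMonoid M) {a b c : M} (h : a * b = a * c) : b = c :=
  hM.cancel a b c 1 (by simpa using h)

theorem mul_right_cancel (hM : IsGarsideMonoid M) {a b c : M} (h : b * a = c * a) : b = c :=
  hM.cancel 1 b c a (by simpa using h)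

theorem eq_one_of_mul_eq_one (hM : IsGarsideMonoid M) {a b : M} (h : a * b = 1) : a = 1 := by
  obtain ⟨ν, h0, hν⟩ := hM.atomic
  have h1 := hν a b
  rw [h, (h0 1).2 rfl] at h1
  exact (h0 a).1 (by omega)

open OreLocalization in
-- Common left multiples, from the joins for right divisibility, and cancellation make `M` an Ore
-- monoid. It embeds in its localization, to whose units the presented group maps.
theorem ι_injective (hM : IsGarsideMonoid M) : Function.Injective (ι : M → FracGroup M) := by
  have hex : ∀ r s : M, ∃ p : M × M, p.1 * r = p.2 * s := fun r s => by
    obtain ⟨d, ⟨a, ha⟩, ⟨b, hb⟩, -⟩ := hM.right_join r s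
    exact ⟨(a, b), ha.symm.trans hb⟩
  choose f hf using hex
  let _ : OreSet (⊤ : Submonoid M) :=
    { ore_right_cancel := fun a b s h => ⟨1, by rw [hM.mul_right_cancel h]⟩
      oreNum := fun r s => (f r s).2
      oreDenom := fun r s => ⟨(f r s).1, trivial⟩
      ore_eq := fun r s => hf r s }
  let φ : M → (OreLocalization (⊤ : Submonoid M) M)ˣ := fun m => numeratorUnit ⟨m, trivial⟩
  have hφ : ∀ a b, φ (a * b) = φ a * φ b := fun a b => Units.ext <|
    map_mul (numeratorHom : M →* OreLocalization (⊤ : Submonoid M) M) a b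
  have hrel : ∀ r ∈ fracRels M, FreeGroup.lift φ r = 1 := by
    rintro r ⟨a, b, rfl⟩
    simp [hφ]
  intro a b hab
  have h1 : PresentedGroup.toGroup hrel (ι a) = PresentedGroup.toGroup hrel (ι b) := by rw [hab]
  have h2 : φ a = φ b := (PresentedGroup.toGroup.of hrel).symm.trans
    (h1.trans (PresentedGroup.toGroup.of hrel))
  have h3 : (a /ₒ (1 : (⊤ : Submonoid M))) = b /ₒ (1 : (⊤ : Submonoid M)) :=
    congrArg Units.val h2
  obtain ⟨u, v, h4, h5⟩ := oreDiv_eq_iff.1 h3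
  simp only [OneMemClass.coe_one, mul_one] at h5
  rw [Submonoid.smul_def, h5, smul_eq_mul, smul_eq_mul] at h4
  exact (hM.mul_left_cancel h4).symm

theorem leftLE_ι_iff (hM : IsGarsideMonoid M) {a b : M} : LeftLE (ι a) (ι b) ↔ a ∣ b := by
  constructor
  · rintro ⟨m, hm⟩
    refine ⟨m, hM.ι_injective ?_⟩
    rw [map_mul, ← hm, mul_inv_cancel_left]
  · rintro ⟨m, rfl⟩
    exact ⟨m, by simp⟩

theorem leftLE_antisymm (hM : IsGarsideMonoid M) {α β : FracGroup M} (h1 : LeftLE α β)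
    (h2 : LeftLE β α) : α = β := by
  obtain ⟨a, ha⟩ := h1
  obtain ⟨b, hb⟩ := h2
  have hab : a * b = 1 := hM.ι_injective (by rw [map_mul, ← ha, ← hb, map_one]; group)
  rw [hM.eq_one_of_mul_eq_one hab, map_one, inv_mul_eq_one] at ha
  exact ha

variable {Δ : M}

/-- For simple `a` with `a b = Δ`, the complement `b` is simple as well, say `b c = Δ`; hence `a Δ =
Δ c`. The other side is symmetric, and simple elements generate. -/
theorem exists_mul_garside (hΔ : IsGarsideElement Δ) (m : M) :
    (∃ m', m * Δ = Δ * m') ∧ ∃ m', Δ * m = m' * Δ := by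
  have hdiv : ∀ a : M, a ∣ Δ ↔ a ∣ᵣ Δ := fun a => Set.ext_iff.1 hΔ.divisors_eq a
  have hm : m ∈ Submonoid.closure {a : M | a ∣ Δ} := by rw [hΔ.generates]; trivial
  induction hm using Submonoid.closure_induction with
  | mem a ha =>
    constructor
    · obtain ⟨b, hb⟩ : a ∣ Δ := ha
      obtain ⟨c, hc⟩ := (hdiv b).2 ⟨a, hb⟩
      exact ⟨c, by conv_lhs => rw [hc, ← mul_assoc, ← hb]⟩
    · obtain ⟨b, hb⟩ := (hdiv a).1 ha
      obtain ⟨c, hc⟩ := (hdiv b).1 ⟨a, hb⟩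
      exact ⟨c, by conv_lhs => rw [hc, mul_assoc, ← hb]⟩
  | one => exact ⟨⟨1, by simp⟩, 1, by simp⟩
  | mul a b _ _ ha hb =>
    obtain ⟨⟨a1, ha1⟩, a2, ha2⟩ := ha
    obtain ⟨⟨b1, hb1⟩, b2, hb2⟩ := hb
    exact ⟨⟨a1 * b1, by rw [mul_assoc, hb1, ← mul_assoc, ha1, mul_assoc]⟩,
      a2 * b2, by rw [← mul_assoc, ha2, mul_assoc, hb2, mul_assoc]⟩

theorem leftLE_mul_garside_iff (hΔ : IsGarsideElement Δ)
    {α β : FracGroup M} : LeftLE (α * ι Δ) (β * ι Δ) ↔ LeftLE α β := by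
  constructor
  · rintro ⟨m, hm⟩
    obtain ⟨m', hm'⟩ := (exists_mul_garside hΔ m).2
    refine ⟨m', ?_⟩
    have h1 : ι Δ * ι m = ι m' * ι Δ := by rw [← map_mul, hm', map_mul]
    rw [← mul_left_inj (ι Δ), ← h1, ← hm]; group
  · rintro ⟨m, hm⟩
    obtain ⟨m', hm'⟩ := (exists_mul_garside hΔ m).1
    refine ⟨m', ?_⟩
    have h1 : ι m * ι Δ = ι Δ * ι m' := by rw [← map_mul, hm', map_mul]
    rw [← mul_right_inj (ι Δ), ← h1, ← hm]; group

theorem leftLE_mul_pow_garside_iff (hΔ : IsGarsideElement Δ) (n : ℕ)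
    {α β : FracGroup M} : LeftLE (α * ι Δ ^ n) (β * ι Δ ^ n) ↔ LeftLE α β := by
  induction n with
  | zero => simp
  | succ n ih => rw [pow_succ, ← mul_assoc, ← mul_assoc, leftLE_mul_garside_iff hΔ, ih]

theorem one_leftLE_ι (m : M) : LeftLE 1 (ι m) := ⟨m, by simp⟩

theorem exists_leftLE_pow (hM : IsGarsideMonoid M) (hΔ : IsGarsideElement Δ) (g : FracGroup M) :
    ∃ n : ℕ, LeftLE g (ι Δ ^ n) ∧ LeftLE g⁻¹ (ι Δ ^ n) := by
  have hmul : ∀ a b : FracGroup M, ∀ n m : ℕ, LeftLE a (ι Δ ^ n) → LeftLE b (ι Δ ^ m) →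
      LeftLE (a * b) (ι Δ ^ (n + m)) := fun a b n m ha hb => by
    rw [pow_add]
    exact (leftLE_mul_left_iff.2 hb).trans ((leftLE_mul_pow_garside_iff hΔ m).2 ha)
  let H : Subgroup (FracGroup M) :=
    { carrier := {g | ∃ n : ℕ, LeftLE g (ι Δ ^ n) ∧ LeftLE g⁻¹ (ι Δ ^ n)}
      one_mem' := ⟨0, by simpa using LeftLE.refl 1⟩
      mul_mem' := by
        rintro a b ⟨n, hn, hn'⟩ ⟨m, hm, hm'⟩
        refine ⟨n + m, hmul a b n m hn hm, ?_⟩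
        rw [mul_inv_rev, add_comm]
        exact hmul _ _ m n hm' hn'
      inv_mem' := by
        rintro a ⟨n, hn, hn'⟩
        exact ⟨n, hn', by rwa [inv_inv]⟩ }
  have h1 : Submonoid.closure {a : M | a ∣ Δ} ≤ H.toSubmonoid.comap ι := by
    rw [Submonoid.closure_le]
    intro a ha
    refine ⟨1, by simpa using hM.leftLE_ι_iff.2 ha, ?_⟩
    rw [pow_one]
    refine LeftLE.trans ?_ (one_leftLE_ι Δ)
    exact ⟨a, by simp⟩
  rw [hΔ.generates] at h1
  have h2 : (⊤ : Subgroup (FracGroup M)) ≤ H := by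
    rw [← PresentedGroup.closure_range_of, Subgroup.closure_le]
    rintro _ ⟨m, rfl⟩
    exact h1 (Submonoid.mem_top m)
  exact h2 (Subgroup.mem_top g)

theorem exists_pow_mul_eq_ι (hM : IsGarsideMonoid M) (hΔ : IsGarsideElement Δ)
    (g : FracGroup M) : ∃ (n : ℕ) (m : M), ι Δ ^ n * g = ι m := by
  obtain ⟨n, -, m, hm⟩ := hM.exists_leftLE_pow hΔ g
  obtain ⟨k, hk⟩ : ∃ k, LeftLE 1 (ι Δ ^ n * g) ∧ k = n := by
    refine ⟨n, ?_, rfl⟩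
    rw [← leftLE_mul_pow_garside_iff hΔ n, one_mul, mul_assoc]
    refine ⟨m, ?_⟩
    rw [inv_inv] at hm
    rw [hm, inv_mul_cancel_left]
  obtain ⟨⟨m', hm'⟩, -⟩ := hk
  exact ⟨n, m', by simpa using hm'⟩

/-- Left translation by a power of `Δ` moves both elements into `M`. -/
theorem exists_isMeet (hM : IsGarsideMonoid M) (α β : FracGroup M) :
    ∃ d, IsMeet LeftLE α β d := by
  obtain ⟨Δ, hΔ⟩ := hM.garside
  obtain ⟨n, a, b, ha, hb⟩ : ∃ (n : ℕ) (a b : M), ι Δ ^ n * α = ι a ∧ ι Δ ^ n * β = ι b := by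
    obtain ⟨n, a, ha⟩ := hM.exists_pow_mul_eq_ι hΔ α
    obtain ⟨m, b, hb⟩ := hM.exists_pow_mul_eq_ι hΔ β
    refine ⟨m + n, Δ ^ m * a, Δ ^ n * b, ?_, ?_⟩
    · rw [pow_add, mul_assoc, ha, map_mul, map_pow]
    · rw [add_comm, pow_add, mul_assoc, hb, map_mul, map_pow]
  obtain ⟨d, hda, hdb, hd⟩ := hM.left_meet a b
  refine ⟨(ι Δ ^ n)⁻¹ * ι d, ?_, ?_, ?_⟩
  · rw [← leftLE_mul_left_iff (α := ι Δ ^ n), mul_inv_cancel_left, ha, hM.leftLE_ι_iff]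
    exact hda
  · rw [← leftLE_mul_left_iff (α := ι Δ ^ n), mul_inv_cancel_left, hb, hM.leftLE_ι_iff]
    exact hdb
  intro c hca hcb
  rw [← leftLE_mul_left_iff (α := ι Δ ^ n), ha] at hca
  rw [← leftLE_mul_left_iff (α := ι Δ ^ n), hb] at hcb
  rw [← leftLE_mul_left_iff (α := ι Δ ^ n), mul_inv_cancel_left]
  -- A competing lower bound lies only in `G`, so a further shift by `Δ^k` is needed. The meet after
  -- that shift is divisible by `Δ^k`, hence divides `Δ^k * d`.
  obtain ⟨k, c', hc'⟩ := hM.exists_pow_mul_eq_ι hΔ (ι Δ ^ n * c)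
  rw [← leftLE_mul_left_iff (α := ι Δ ^ k), hc', ← map_pow, ← map_mul, hM.leftLE_ι_iff] at hca hcb ⊢
  obtain ⟨D, hDa, hDb, hD⟩ := hM.left_meet (Δ ^ k * a) (Δ ^ k * b)
  obtain ⟨d', rfl⟩ := hD (Δ ^ k) (Dvd.intro _ rfl) (Dvd.intro _ rfl)
  have cancel : ∀ x y : M, Δ ^ k * x ∣ Δ ^ k * y → x ∣ y := by
    rintro x y ⟨z, hz⟩
    exact ⟨z, hM.mul_left_cancel (by rw [hz, mul_assoc])⟩
  exact (hD c' hca hcb).trans (mul_dvd_mul_left _ (hd d' (cancel _ _ hDa) (cancel _ _ hDb)))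

/-- The group of fractions of a Garside monoid, ordered by `LeftLE`, is a meet-semilattice. -/
noncomputable abbrev semilatticeInf (hM : IsGarsideMonoid M) : SemilatticeInf (FracGroup M) where
  le := LeftLE
  le_refl := LeftLE.refl
  le_trans _ _ _ := LeftLE.trans
  le_antisymm _ _ := hM.leftLE_antisymm
  inf α β := Classical.choose (hM.exists_isMeet α β)
  inf_le_left α β := (Classical.choose_spec (hM.exists_isMeet α β)).1
  inf_le_right α β := (Classical.choose_spec (hM.exists_isMeet α β)).2.1
  le_inf γ α β h1 h2 := (Classical.choose_spec (hM.exists_isMeet α β)).2.2 γ h1 h2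

/-- A nontrivial generator has norm at least 1, so norm at most `n` leaves only products of at most
`n` of the finitely many generators. -/
theorem finite_norm_le (hM : IsGarsideMonoid M) {ν : M → ℕ} (h0 : ∀ a, ν a = 0 ↔ a = 1)
    (hν : ∀ a b, ν a + ν b ≤ ν (a * b)) (n : ℕ) : {m : M | ν m ≤ n}.Finite := by
  obtain ⟨S, hS⟩ := hM.fg.fg_top
  have hfin := ((List.finite_length_le S n).image fun l => (l.map Subtype.val).prod)
  refine hfin.subset fun m hm => ?_
  have key : ∀ m ∈ Submonoid.closure (S : Set M),
      ∃ l : List S, (l.map Subtype.val).prod = m ∧ l.length ≤ ν m := by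
    intro m hm
    induction hm using Submonoid.closure_induction with
    | mem a ha =>
      by_cases h : a = 1
      · exact ⟨[], by simp [h], by simp⟩
      · refine ⟨[⟨a, ha⟩], by simp, ?_⟩
        have := (h0 a).not.2 h
        simp only [List.length_cons, List.length_nil]; omega
    | one => exact ⟨[], by simp, by simp⟩
    | mul a b _ _ ha hb =>
      obtain ⟨l, rfl, hl⟩ := ha
      obtain ⟨k, rfl, hk⟩ := hb
      refine ⟨l ++ k, by simp, ?_⟩
      rw [List.length_append]
      exact (Nat.add_le_add hl hk).trans (hν _ _)
  obtain ⟨l, hl, hlen⟩ := key m (by rw [hS]; trivial)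
  exact ⟨l, hlen.trans hm, hl⟩

theorem isGarsideOrder (hM : IsGarsideMonoid M) (hΔ : IsGarsideElement Δ) (hΔ1 : Δ ≠ 1) :
    letI := hM.semilatticeInf
    IsGarsideOrder (ι Δ) := by
  let _ := hM.semilatticeInf
  refine ⟨fun a b c => leftLE_mul_left_iff.2, fun a b => leftLE_mul_garside_iff hΔ,
    lt_of_le_of_ne (one_leftLE_ι Δ) fun h => hΔ1 (hM.ι_injective (by rw [← h, map_one])),
    fun g => (hM.exists_leftLE_pow hΔ g).imp fun n hn => hn.1, fun n => ?_⟩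
  obtain ⟨ν, h0, hν⟩ := hM.atomic
  refine ((hM.finite_norm_le h0 hν (ν (Δ ^ n))).image ι).subset ?_
  rintro g ⟨⟨m, hm⟩, hg⟩
  obtain rfl : g = ι m := by simpa using hm
  rw [← map_pow] at hg
  obtain ⟨k, hk⟩ := hM.leftLE_ι_iff.1 hg
  refine ⟨m, ?_, rfl⟩
  have := hν m k
  rw [← hk] at this
  exact (Nat.le_add_right _ _).trans this

theorem subsingleton_of_garside_eq_one (hM : IsGarsideMonoid M) (hΔ : IsGarsideElement (1 : M)) :
    Subsingleton (FracGroup M) := by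
  have hone : ∀ m : M, m = 1 := fun m => by
    have hm : m ∈ Submonoid.closure {a : M | a ∣ 1} := by rw [hΔ.generates]; trivial
    have hle : Submonoid.closure {a : M | a ∣ 1} ≤ ⊥ := by
      rw [Submonoid.closure_le]
      rintro a ⟨b, hb⟩
      exact hM.eq_one_of_mul_eq_one hb.symm
    exact Submonoid.mem_bot.1 (hle hm)
  refine subsingleton_of_forall_eq 1 fun g => ?_
  obtain ⟨n, m, hm⟩ := hM.exists_pow_mul_eq_ι hΔ g
  rw [hone m] at hm
  simpa using hm

end IsGarsideMonoid

end Garside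

namespace Garside

/-! ### Meets with powers of `Δ`. -/

theorem IsGarsideOrder.inf_pow_eq_one {G : Type u} [Group G] [SemilatticeInf G] {Δ : G}
    (h : IsGarsideOrder Δ) {x : G} (hx : 1 ≤ x) (hx1 : x ⊓ Δ = 1) (n : ℕ) : x ⊓ Δ ^ n = 1 := by
  induction n with
  | zero => simpa using hx
  | succ n ih =>
    apply le_antisymm _ (le_inf hx (h.one_le_pow _))
    rw [← ih]
    refine le_inf inf_le_left ?_
    have e : (x ⊓ Δ) * Δ ^ (n : ℤ) = x * Δ ^ (n : ℤ) ⊓ Δ * Δ ^ (n : ℤ) := h.inf_mul_zpow _ _ _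
    rw [hx1, one_mul, zpow_natCast, ← pow_succ'] at e
    rw [e]
    exact inf_le_inf_right _ (by simpa using h.mul_left_le x _ _ (h.one_le_pow n))

theorem IsGarsideOrder.eq_one_of_inf_eq_one {G : Type u} [Group G] [SemilatticeInf G] {Δ : G}
    (h : IsGarsideOrder Δ) {x : G} (hx : 1 ≤ x) (hx1 : x ⊓ Δ = 1) : x = 1 := by
  obtain ⟨n, hn⟩ := h.exists_le_pow x
  rw [← inf_eq_left.2 hn, h.inf_pow_eq_one hx hx1]

/-! ### Normal forms and the sliding -/

namespace IsGarsideMonoid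

variable {M : Type u} [Monoid M] {Δ : M}

theorem ι_inf_eq (hM : IsGarsideMonoid M) {a b d : M} (hd : IsMeet (· ∣ ·) a b d) :
    letI := hM.semilatticeInf
    ι a ⊓ ι b = (ι d : FracGroup M) := by
  let _ := hM.semilatticeInf
  apply le_antisymm
  · have h1 : (1 : FracGroup M) ≤ ι a ⊓ ι b := le_inf (one_leftLE_ι a) (one_leftLE_ι b)
    obtain ⟨m, hm⟩ := h1
    rw [inv_one, one_mul] at hm
    have ha : (ι m : FracGroup M) ≤ ι a := hm ▸ inf_le_left
    have hb : (ι m : FracGroup M) ≤ ι b := hm ▸ inf_le_right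
    rw [hm]
    exact hM.leftLE_ι_iff.2 (hd.2.2 m (hM.leftLE_ι_iff.1 ha) (hM.leftLE_ι_iff.1 hb))
  · exact le_inf (hM.leftLE_ι_iff.2 hd.1) (hM.leftLE_ι_iff.2 hd.2.1)

theorem isMeet_leftLE_iff (hM : IsGarsideMonoid M) {α β d : FracGroup M} :
    letI := hM.semilatticeInf
    IsMeet LeftLE α β d ↔ d = α ⊓ β := by
  let _ := hM.semilatticeInf
  constructor
  · rintro ⟨h1, h2, h3⟩
    have h4 : α ⊓ β ≤ d := h3 _ (inf_le_left : α ⊓ β ≤ α) (inf_le_right : α ⊓ β ≤ β)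
    exact le_antisymm (le_inf h1 h2) h4
  · rintro rfl
    exact ⟨(inf_le_left : α ⊓ β ≤ α), (inf_le_right : α ⊓ β ≤ β),
      fun c (h1 : c ≤ α) (h2 : c ≤ β) => (le_inf h1 h2 : c ≤ α ⊓ β)⟩

theorem exists_isNormalForm (hM : IsGarsideMonoid M) (hΔ : IsGarsideElement Δ) (hΔ1 : Δ ≠ 1)
    (m : M) : ∃ l : List M, l.prod = m ∧ IsNormalForm Δ l := by
  let _ := hM.semilatticeInf
  have h := hM.isGarsideOrder hΔ hΔ1
  obtain ⟨ν, h0, hν⟩ := hM.atomic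
  induction hn : ν m using Nat.strong_induction_on generalizing m with
  | _ n ih =>
    by_cases hm : m = 1
    · exact ⟨[], by simp [hm], trivial⟩
    obtain ⟨a, ha⟩ := hM.left_meet Δ m
    have ha1 : a ≠ 1 := by
      rintro rfl
      have h1 := hM.ι_inf_eq ha
      rw [inf_comm, map_one] at h1
      have h2 := h.eq_one_of_inf_eq_one (one_leftLE_ι m) h1
      exact hm (hM.ι_injective (by rw [h2, map_one]))
    obtain ⟨m', rfl⟩ := ha.2.1
    have hlt : ν m' < n := by
      have := hν a m'
      have := (h0 a).not.2 ha1
      omega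
    obtain ⟨l, rfl, hl⟩ := ih _ hlt m' rfl
    exact ⟨a :: l, by simp, ha1, ha, hl⟩

theorem exists_isDeltaNormalForm (hM : IsGarsideMonoid M) (hΔ : IsGarsideElement Δ)
    (hΔ1 : Δ ≠ 1) (α : FracGroup M) :
    ∃ x : ℤ × List M, IsDeltaNormalForm Δ α x.1 x.2 := by
  let _ := hM.semilatticeInf
  have h := hM.isGarsideOrder hΔ hΔ1
  obtain ⟨m, hm⟩ := h.zpow_infimum_le α
  obtain ⟨l, rfl, hl⟩ := hM.exists_isNormalForm hΔ hΔ1 m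
  refine ⟨(infimum (ι Δ) α, l), ?_, ?_, hl⟩
  · rw [← hm, mul_inv_cancel_left]
  · intro q b hq
    exact h.le_infimum_iff.2 ⟨b, by rw [hq, inv_mul_cancel_left]⟩

/-- This recovers the product without its last factor as a meet. It yields both the supremum and the
terminal factor. -/
theorem inf_pow_of_isNormalForm (hM : IsGarsideMonoid M) (hΔ : IsGarsideElement Δ)
    (hΔ1 : Δ ≠ 1) {k : List M} {a : M} (hk : IsNormalForm Δ (k ++ [a])) :
    letI := hM.semilatticeInf
    ι (k ++ [a]).prod ⊓ ι Δ ^ k.length = (ι k.prod : FracGroup M) := by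
  let _ := hM.semilatticeInf
  have h := hM.isGarsideOrder hΔ hΔ1
  induction k with
  | nil => simpa using! one_leftLE_ι a
  | cons b k ih =>
    obtain ⟨-, hb, hk⟩ := hk
    have hb' : ι Δ ⊓ ι (b * (k ++ [a]).prod) = ι b := hM.ι_inf_eq hb
    have ih' := ih hk
    simp only [List.cons_append, List.prod_cons, List.length_cons]
    set P := (k ++ [a]).prod
    rw [map_mul ι b k.prod, ← ih', h.mul_inf_eq, ← map_mul, ← hb', ← zpow_natCast (ι Δ) k.length,
      h.inf_mul_zpow, zpow_natCast, ← pow_succ', inf_comm (ι Δ ^ (k.length + 1)), ← inf_assoc,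
      inf_eq_left.2 (show ι (b * P) ≤ ι (b * P) * ι Δ ^ k.length by
        simpa only [mul_one] using h.mul_left_le (ι (b * P)) _ _ (h.one_le_pow k.length))]

theorem isNormalForm_forall_dvd {l : List M} (hl : IsNormalForm Δ l) : ∀ a ∈ l, a ≠ 1 ∧ a ∣ Δ := by
  induction l with
  | nil => simp
  | cons b l ih =>
    intro a ha
    rcases List.mem_cons.1 ha with rfl | ha
    · exact ⟨hl.1, hl.2.1.1⟩
    · exact ih hl.2.2 a ha

theorem ι_prod_le_pow (hM : IsGarsideMonoid M) (hΔ : IsGarsideElement Δ) (hΔ1 : Δ ≠ 1)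
    {l : List M} (hl : ∀ a ∈ l, a ∣ Δ) :
    letI := hM.semilatticeInf
    (ι l.prod : FracGroup M) ≤ ι Δ ^ l.length := by
  let _ := hM.semilatticeInf
  have h := hM.isGarsideOrder hΔ hΔ1
  induction l with
  | nil => simp
  | cons b l ih =>
    rw [List.prod_cons, map_mul, List.length_cons, pow_succ']
    refine (h.mul_left_le _ _ _ (ih fun a ha => hl a (List.mem_cons_of_mem _ ha))).trans ?_
    exact (h.mul_pow_le_iff _).2 (hM.leftLE_ι_iff.2 (hl b List.mem_cons_self))

/-- With `α = Δ^p a₁ ⋯ a_r`, the initial factor is `Δ ⊓ α Δ^(-p)`. The complement of `a_r` is the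
same expression for `α⁻¹`, whose infimum is `-(p + r)`. -/
theorem slidingPrefix_eq_pre (hM : IsGarsideMonoid M) (hΔ : IsGarsideElement Δ) (hΔ1 : Δ ≠ 1)
    (α : FracGroup M) :
    letI := hM.semilatticeInf
    slidingPrefix Δ α = pre (ι Δ) α := by
  let _ := hM.semilatticeInf
  have h := hM.isGarsideOrder hΔ hΔ1
  have hmeet : slidingPrefix Δ α = initialFactor Δ α ⊓ star Δ (terminalFactor Δ α) :=
    hM.isMeet_leftLE_iff.1 (Classical.epsilon_spec
      (hM.exists_isMeet (initialFactor Δ α) (star Δ (terminalFactor Δ α))))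
  have hnf : IsDeltaNormalForm Δ α (deltaNormalForm Δ α).1 (deltaNormalForm Δ α).2 :=
    Classical.epsilon_spec (hM.exists_isDeltaNormalForm hΔ hΔ1 α)
  rw [hmeet, initialFactor, terminalFactor, star, pre]
  generalize deltaNormalForm Δ α = x at hnf
  obtain ⟨p, l⟩ := x
  obtain ⟨hα, hmax, hl⟩ := hnf
  dsimp only at *
  have hp : infimum (ι Δ) α = p := by
    apply le_antisymm
    · obtain ⟨m, hm⟩ := h.zpow_infimum_le α
      exact hmax _ m (by rw [← hm, mul_inv_cancel_left])
    · exact h.le_infimum_iff.2 ⟨l.prod, by rw [hα, inv_mul_cancel_left]⟩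
  rw [hp]
  -- For `r = 0` the default values 1 and `Δ` give a trivial prefix, in agreement with `pre` at
  -- `Δ^p`.
  rcases List.eq_nil_or_concat l with rfl | ⟨k, a, rfl⟩
  · obtain rfl : α = ι Δ ^ p := by simpa using hα
    have hq : infimum (ι Δ) (ι Δ ^ p)⁻¹ = -p := by
      rw [← zpow_neg, h.infimum_eq_iff]
      exact ⟨le_rfl, fun H => by have := h.zpow_le_iff.1 H; omega⟩
    simp only [hq, zpow_neg, neg_neg, List.headD_nil, List.getLastD_nil, map_one, mul_one,
      inv_mul_cancel, mul_inv_cancel, zpow_neg]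
    rw [inf_eq_right.2 h.one_lt.le]
  · rw [List.concat_eq_append] at hl hα ⊢
    have hi : ι Δ ^ p * ι ((k ++ [a]).headD 1) * (ι Δ ^ p)⁻¹ = ι Δ ⊓ α * ι Δ ^ (-p) := by
      have : ι ((k ++ [a]).headD 1) = ι Δ ⊓ (ι (k ++ [a]).prod : FracGroup M) := by
        cases k with
        | nil => exact (hM.ι_inf_eq hl.2.1).symm
        | cons b k => exact (hM.ι_inf_eq hl.2.1).symm
      rw [this, ← zpow_neg, h.mul_inf_eq, ← hα, h.inf_mul_zpow,
        ((Commute.refl (ι Δ)).zpow_left p).eq, mul_assoc, ← zpow_add, add_neg_cancel, zpow_zero,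
        mul_one]
    have hinf := hM.inf_pow_of_isNormalForm hΔ hΔ1 hl
    have hall := isNormalForm_forall_dvd hl
    have hq : infimum (ι Δ) α⁻¹ = -(p + k.length + 1) := by
      apply le_antisymm
      · by_contra! hlt
        have h1 : -(p + k.length) ≤ infimum (ι Δ) α⁻¹ := by omega
        rw [h.le_infimum_inv_iff, hα, neg_neg, zpow_add, h.mul_le_mul_left_iff,
          zpow_natCast] at h1
        rw [inf_eq_left.2 h1, List.prod_append, map_mul, mul_eq_left] at hinf
        exact (hall a (by simp)).1 (hM.ι_injective (by simpa using hinf))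
      · rw [h.le_infimum_inv_iff, hα, neg_neg, add_assoc, zpow_add, h.mul_le_mul_left_iff]
        have := hM.ι_prod_le_pow hΔ hΔ1 fun a ha => (hall a ha).2
        rw [List.length_append, ← zpow_natCast] at this
        exact_mod_cast this
    have ht : (ι ((k ++ [a]).getLastD Δ))⁻¹ * ι Δ =
        ι Δ ⊓ α⁻¹ * ι Δ ^ (-infimum (ι Δ) α⁻¹) := by
      have e1 : (k ++ [a]).getLastD Δ = a := by simp
      rw [e1, hq, neg_neg, ← mul_right_inj (ι (k ++ [a]).prod), h.mul_inf_eq]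
      have e2 : ι (k ++ [a]).prod * (α⁻¹ * ι Δ ^ (p + (k.length : ℤ) + 1)) =
          ι Δ ^ (k.length : ℤ) * ι Δ ^ (1 : ℤ) := by
        rw [← zpow_add, hα]
        have : p + (k.length : ℤ) + 1 = p + (k.length + 1) := by ring
        rw [this, zpow_add]; group
      have e3 := h.inf_mul_zpow 1 (ι (k ++ [a]).prod) (ι Δ ^ k.length)
      rw [e2, zpow_natCast, ← zpow_one (ι Δ)]
      simp only [zpow_one] at e3 ⊢
      rw [← e3, hinf]
      simp
    rw [hi, ht, ← inf_inf_distrib_left, inf_assoc]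

theorem sliding_eq_slide (hM : IsGarsideMonoid M) (hΔ : IsGarsideElement Δ) (hΔ1 : Δ ≠ 1) :
    letI := hM.semilatticeInf
    sliding Δ = slide (ι Δ : FracGroup M) := by
  let _ := hM.semilatticeInf
  funext α
  rw [sliding, slide, hM.slidingPrefix_eq_pre hΔ hΔ1]

theorem mem_SC_iff (hM : IsGarsideMonoid M) (hΔ : IsGarsideElement Δ) (hΔ1 : Δ ≠ 1)
    {α β : FracGroup M} :
    letI := hM.semilatticeInf
    β ∈ SC Δ α ↔ IsConj β α ∧ β ∈ Function.periodicPts (slide (ι Δ : FracGroup M)) := by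
  let _ := hM.semilatticeInf
  rw [SC, hM.sliding_eq_slide hΔ hΔ1]
  rfl

end IsGarsideMonoid

end Garside

namespace Garside

/-! ### Words -/

namespace Word

variable {G : Type u} [Group G] {n : ℕ} (x : Fin n → G)

theorem eval_cons (s : Fin n × Bool) (w : Word n) :
    eval x (s :: w : Word n) = eval x ([s] : Word n) * eval x w := by
  simp [eval]

theorem eval_append (v w : Word n) : eval x (v ++ w : Word n) = eval x v * eval x w := by
  simp [eval]

/-- The formal inverse of a word. -/
def inv (w : Word n) : Word n := (w.map fun s => (s.1, !s.2)).reverse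

theorem eval_inv (w : Word n) : eval x (inv w) = (eval x w)⁻¹ := by
  induction w with
  | nil => simp [inv, eval]
  | cons s w ih =>
    have : inv (s :: w : Word n) = inv w ++ [(s.1, !s.2)] := by simp [inv]
    rw [this, eval_append, ih, eval_cons x s w, mul_inv_rev]
    congr 1
    obtain ⟨i, b⟩ := s
    cases b <;> simp [eval]

/-- The word `c⁻¹ w c`. -/
def conj (w c : Word n) : Word n := inv c ++ w ++ c

theorem eval_conj (w c : Word n) : eval x (conj w c) = (eval x c)⁻¹ * eval x w * eval x c := by
  rw [conj, eval_append, eval_append, eval_inv]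

/-- The `m`-th power of a word. -/
def pow (w : Word n) (m : ℕ) : Word n := (fun v => w ++ v)^[m] []

theorem eval_pow (w : Word n) (m : ℕ) : eval x (pow w m) = eval x w ^ m := by
  induction m with
  | zero => simp [pow, eval]
  | succ m ih => rw [pow, Function.iterate_succ_apply', eval_append, ← pow, ih, pow_succ']

variable {x}

theorem eval_surjective (hx : Subgroup.closure (Set.range x) = ⊤) :
    Function.Surjective (eval x) := by
  intro g
  have hg : g ∈ Subgroup.closure (Set.range x) := by rw [hx]; trivial
  induction hg using Subgroup.closure_induction with
  | mem g hg =>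
    obtain ⟨i, rfl⟩ := hg
    exact ⟨[(i, true)], by simp [eval]⟩
  | one => exact ⟨[], rfl⟩
  | mul a b _ _ ha hb =>
    obtain ⟨v, rfl⟩ := ha
    obtain ⟨w, rfl⟩ := hb
    exact ⟨v ++ w, eval_append x v w⟩
  | inv a _ ha =>
    obtain ⟨v, rfl⟩ := ha
    exact ⟨inv v, eval_inv x v⟩

theorem primrec_inv : Primrec (inv : Word n → Word n) :=
  Primrec.list_reverse.comp (Primrec.list_map Primrec.id
    (Primrec.pair (Primrec.fst.comp Primrec.snd)
      (Primrec.not.comp (Primrec.snd.comp Primrec.snd))).to₂)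

theorem primrec_conj : Primrec₂ (conj : Word n → Word n → Word n) :=
  Primrec.list_append.comp
    (Primrec.list_append.comp (primrec_inv.comp Primrec.snd) Primrec.fst) Primrec.snd

theorem primrec_pow : Primrec₂ (pow : Word n → ℕ → Word n) :=
  Primrec.nat_iterate Primrec.snd (Primrec.const [])
    (Primrec.list_append.comp (Primrec.fst.comp Primrec.fst) Primrec.snd).to₂

end Word

/-! ### Deciding positivity -/

namespace IsGarsideOrder

variable {G : Type u} [Group G] [SemilatticeInf G] {Δ : G}

/-- Conjugation by `Δ` preserves the order and fixes powers of `Δ`, so the conjugates of `g` by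
powers of `Δ` stay in a finite interval and repeat. -/
theorem exists_pow_commute (h : IsGarsideOrder Δ) (g : G) :
    ∃ e : ℕ, 0 < e ∧ Commute (Δ ^ e) g := by
  obtain ⟨n, hn1, hn2⟩ := h.exists_zpow_bounds g
  have hconj : ∀ (k : ℕ) (z : ℤ), (Δ ^ k)⁻¹ * Δ ^ z * Δ ^ k = Δ ^ z := fun k z => by
    rw [mul_assoc, ((Commute.refl Δ).zpow_left z).pow_right k |>.eq, inv_mul_cancel_left]
  have hmono : ∀ (k : ℕ) {a b : G}, a ≤ b →
      (Δ ^ k)⁻¹ * a * Δ ^ k ≤ (Δ ^ k)⁻¹ * b * Δ ^ k := fun k a b hab =>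
    (h.mul_pow_le_iff k).2 (h.mul_left_le _ _ _ hab)
  obtain ⟨i, j, hij, he⟩ := Set.Finite.exists_lt_map_eq_of_forall_mem
    (f := fun k : ℕ => (Δ ^ k)⁻¹ * g * Δ ^ k) (t := Set.Icc (Δ ^ (-(n : ℤ))) (Δ ^ (n : ℤ)))
    (fun k => ⟨(hconj k _).symm.le.trans (hmono k hn1), (hmono k hn2).trans (hconj k _).le⟩)
    (h.finite_Icc_all _ _)
  obtain ⟨d, rfl⟩ := Nat.exists_eq_add_of_lt hij
  refine ⟨d + 1, by omega, ?_⟩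
  have e1 : Δ ^ (i + d + 1) = Δ ^ (d + 1) * Δ ^ i := by rw [← pow_add]; congr 1; omega
  simp only [e1, mul_inv_rev, mul_assoc, mul_right_inj] at he
  simp only [← mul_assoc, mul_left_inj] at he
  rw [mul_assoc, eq_inv_mul_iff_mul_eq] at he
  exact he

theorem exists_central_pow (h : IsGarsideOrder Δ) {n : ℕ} {x : Fin n → G}
    (hx : Subgroup.closure (Set.range x) = ⊤) :
    ∃ e : ℕ, 0 < e ∧ ∀ g, Commute (Δ ^ e) g := by
  choose e he hc using fun i => h.exists_pow_commute (x i)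
  refine ⟨∏ i, e i, Finset.prod_pos fun i _ => he i, fun g => ?_⟩
  have hle : Subgroup.closure (Set.range x) ≤ Subgroup.centralizer {Δ ^ ∏ i, e i} := by
    rw [Subgroup.closure_le]
    rintro _ ⟨i, rfl⟩
    rw [SetLike.mem_coe, Subgroup.mem_centralizer_singleton_iff]
    obtain ⟨m, hm⟩ := Finset.dvd_prod_of_mem e (Finset.mem_univ i)
    rw [hm, pow_mul]
    exact ((hc i).pow_left m).symm
  rw [hx] at hle
  exact (Subgroup.mem_centralizer_singleton_iff.1 (hle (Subgroup.mem_top g))).symm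

theorem exists_list_prod_eq (h : IsGarsideOrder Δ) {g : G} (hg : 1 ≤ g) :
    ∃ l : List (Set.Icc 1 Δ), (l.map Subtype.val).prod = g := by
  obtain ⟨n, hn⟩ := h.exists_le_pow g
  induction n generalizing g with
  | zero => exact ⟨[], le_antisymm hg (by simpa using hn)⟩
  | succ n ih =>
    obtain ⟨l, hl⟩ := ih (g := (g ⊓ Δ)⁻¹ * g)
      (by
        rw [← h.mul_le_mul_left_iff (a := g ⊓ Δ), mul_inv_cancel_left, mul_one]
        exact inf_le_left)
      (by
        rw [← h.mul_le_mul_left_iff (a := g ⊓ Δ), mul_inv_cancel_left, ← zpow_natCast,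
          h.inf_mul_zpow, zpow_natCast, ← pow_succ']
        exact le_inf (by simpa using h.mul_left_le g _ _ (h.one_le_pow n)) hn)
    exact ⟨⟨g ⊓ Δ, le_inf hg h.one_lt.le, inf_le_right⟩ :: l, by
      rw [List.map_cons, List.prod_cons, hl, mul_inv_cancel_left]⟩

end IsGarsideOrder

section Head

variable {G : Type u} [Group G] [SemilatticeInf G] {Δ : G} {k : ℕ}

/-- Given tables `hd` and `tl` for products of two simple elements, one pass over a word in the
simple elements, splitting off the greatest simple left divisor of the product. -/
def headPass (hd tl : Fin k → Fin k → Fin k) (o : Fin k) (l : List (Fin k)) :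
    Fin k × List (Fin k) :=
  l.foldr (fun a q => (hd a q.1, tl a q.1 :: q.2)) (o, [])

theorem primrec_headPass (hd tl : Fin k → Fin k → Fin k) (o : Fin k) :
    Primrec (headPass hd tl o) := by
  have hh : Primrec₂ hd := (Primrec.dom_finite fun p : Fin k × Fin k => hd p.1 p.2).to₂
  have ht : Primrec₂ tl := (Primrec.dom_finite fun p : Fin k × Fin k => tl p.1 p.2).to₂
  have ha : Primrec fun p : List (Fin k) × Fin k × Fin k × List (Fin k) => p.2.1 :=
    Primrec.fst.comp Primrec.snd
  have hq : Primrec fun p : List (Fin k) × Fin k × Fin k × List (Fin k) => p.2.2 :=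
    Primrec.snd.comp Primrec.snd
  exact Primrec.list_foldr Primrec.id (Primrec.const (o, []))
    (Primrec.pair (hh.comp ha (Primrec.fst.comp hq))
      (Primrec.list_cons.comp (ht.comp ha (Primrec.fst.comp hq)) (Primrec.snd.comp hq))).to₂

/-- For positive `a`, `a b ⊓ Δ = a (b ⊓ Δ) ⊓ Δ`, so the head of a product depends only on `a` and
the head of `b`. A right fold with a finite table suffices. -/
theorem headPass_spec (h : IsGarsideOrder Δ) {σ : Fin k → G} {hd tl : Fin k → Fin k → Fin k}
    {o : Fin k} (hσ : ∀ i, 1 ≤ σ i) (ho : σ o = 1)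
    (hhd : ∀ i j, σ (hd i j) = σ i * σ j ⊓ Δ)
    (htl : ∀ i j, σ (tl i j) = (σ (hd i j))⁻¹ * (σ i * σ j)) (l : List (Fin k)) :
    (l.map σ).prod = σ (headPass hd tl o l).1 * ((headPass hd tl o l).2.map σ).prod ∧
      σ (headPass hd tl o l).1 = (l.map σ).prod ⊓ Δ := by
  induction l with
  | nil => simp [headPass, ho, h.one_lt.le]
  | cons a l ih =>
    obtain ⟨h1, h2⟩ := ih
    have e : headPass hd tl o (a :: l) = (hd a (headPass hd tl o l).1,
      tl a (headPass hd tl o l).1 :: (headPass hd tl o l).2) := rfl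
    rw [e]
    constructor
    · simp only [List.map_cons, List.prod_cons, htl]
      rw [h1]; group
    · simp only [List.map_cons, List.prod_cons, hhd]
      have e1 := h.inf_mul_zpow 1 (σ a) (σ a)
      rw [h2, h.mul_inf_eq, inf_assoc, inf_eq_right.2 (show Δ ≤ σ a * Δ by
        simpa using (h.mul_right_le _ _).2 (hσ a))]

/-- Testing repeatedly whether `Δ` is a left divisor, and dividing by it. -/
def headStep (hd tl : Fin k → Fin k → Fin k) (o t : Fin k) (q : Bool × List (Fin k)) :
    Bool × List (Fin k) :=
  (q.1 && decide ((headPass hd tl o q.2).1 = t), (headPass hd tl o q.2).2)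

theorem primrec_headStep (hd tl : Fin k → Fin k → Fin k) (o t : Fin k) :
    Primrec (headStep hd tl o t) := by
  have hp : Primrec fun q : Bool × List (Fin k) => headPass hd tl o q.2 :=
    (primrec_headPass hd tl o).comp Primrec.snd
  refine Primrec.pair (Primrec.and.comp Primrec.fst ?_) (Primrec.snd.comp hp)
  exact (Primrec.dom_finite fun i : Fin k => decide (i = t)).comp (Primrec.fst.comp hp)

theorem headStep_iterate (h : IsGarsideOrder Δ) {σ : Fin k → G} {hd tl : Fin k → Fin k → Fin k}
    {o t : Fin k} (hσ : ∀ i, 1 ≤ σ i) (hinj : Function.Injective σ) (ho : σ o = 1) (ht : σ t = Δ)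
    (hhd : ∀ i j, σ (hd i j) = σ i * σ j ⊓ Δ)
    (htl : ∀ i j, σ (tl i j) = (σ (hd i j))⁻¹ * (σ i * σ j)) (m : ℕ) (b : Bool)
    (l : List (Fin k)) :
    ((headStep hd tl o t)^[m] (b, l)).1 = true ↔ b = true ∧ Δ ^ m ≤ (l.map σ).prod := by
  have hpos : ∀ l : List (Fin k), 1 ≤ (l.map σ).prod := fun l => by
    induction l with
    | nil => simp
    | cons a l ih =>
      rw [List.map_cons, List.prod_cons]
      exact (hσ a).trans (by simpa using h.mul_left_le (σ a) _ _ ih)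
  induction m generalizing b l with
  | zero => simp [hpos l]
  | succ m ih =>
    obtain ⟨h1, h2⟩ := headPass_spec h hσ ho hhd htl l
    rw [Function.iterate_succ_apply]
    refine (ih _ _).trans ?_
    simp only [Bool.and_eq_true, decide_eq_true_eq, and_assoc]
    refine and_congr_right fun _ => ?_
    constructor
    · rintro ⟨h3, h4⟩
      rw [h1, h3, ht, pow_succ']
      exact h.mul_left_le _ _ _ h4
    · intro h3
      have h4 : Δ ≤ (l.map σ).prod := by
        refine le_trans ?_ h3
        rw [pow_succ']
        simpa using h.mul_left_le Δ _ _ (h.one_le_pow m)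
      rw [inf_eq_right.2 h4] at h2
      refine ⟨hinj (h2.trans ht.symm), ?_⟩
      rwa [h1, h2, pow_succ', h.mul_le_mul_left_iff] at h3

theorem IsGarsideOrder.exists_enum (h : IsGarsideOrder Δ) :
    ∃ (k : ℕ) (σ : Fin k → G), Function.Injective σ ∧ Set.range σ = Set.Icc 1 Δ := by
  have hfin : Finite (Set.Icc 1 Δ) := h.finite_Icc_all 1 Δ
  obtain ⟨k, ⟨e⟩⟩ := Finite.exists_equiv_fin (Set.Icc 1 Δ)
  refine ⟨k, fun i => (e.symm i : G), Subtype.val_injective.comp e.symm.injective, ?_⟩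
  ext g
  constructor
  · rintro ⟨i, rfl⟩; exact (e.symm i).2
  · intro hg; exact ⟨e ⟨g, hg⟩, by simp⟩

/-- Positivity of the element represented by a word is a primitive recursive property. -/
theorem IsGarsideOrder.primrecPred_one_le (h : IsGarsideOrder Δ) {n : ℕ} {x : Fin n → G}
    (hx : Subgroup.closure (Set.range x) = ⊤) :
    PrimrecPred fun w : Word n => 1 ≤ Word.eval x w := by
  obtain ⟨k, σ, hinj, hrange⟩ := h.exists_enum
  have hσ : ∀ i, 1 ≤ σ i ∧ σ i ≤ Δ := fun i =>
    (hrange ▸ Set.mem_range_self i : σ i ∈ Set.Icc 1 Δ)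
  have hex : ∀ g, 1 ≤ g → g ≤ Δ → ∃ i, σ i = g := fun g h1 h2 => by
    have : g ∈ Set.Icc 1 Δ := ⟨h1, h2⟩
    rwa [← hrange] at this
  obtain ⟨o, ho⟩ := hex 1 le_rfl h.one_lt.le
  obtain ⟨t, ht⟩ := hex Δ h.one_lt.le le_rfl
  have one_le_mul : ∀ a b : G, 1 ≤ a → 1 ≤ b → 1 ≤ a * b := fun a b ha hb =>
    ha.trans (by simpa using h.mul_left_le a _ _ hb)
  choose hd hhd using fun i j => hex (σ i * σ j ⊓ Δ)
    (le_inf (one_le_mul _ _ (hσ i).1 (hσ j).1) h.one_lt.le) inf_le_right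
  choose tl htl using fun i j => hex ((σ (hd i j))⁻¹ * (σ i * σ j))
    (by
      rw [← h.mul_le_mul_left_iff (a := σ (hd i j)), mul_inv_cancel_left, mul_one, hhd]
      exact inf_le_left)
    (by
      rw [← h.mul_le_mul_left_iff (a := σ (hd i j)), mul_inv_cancel_left, hhd, ← zpow_one Δ,
        h.inf_mul_zpow, zpow_one]
      refine le_inf ?_ ?_
      · simpa using h.mul_left_le (σ i * σ j) _ _ h.one_lt.le
      · exact (h.mul_left_le _ _ _ (hσ j).2).trans ((h.mul_right_le _ _).2 (hσ i).2))
  obtain ⟨e, he, hcentral⟩ := h.exists_central_pow hx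
  choose N hN1 hN2 using fun s : Fin n × Bool => h.exists_zpow_bounds (Word.eval x [s])
  -- Large enough that every letter times `Δ^K` is positive, and a multiple of `e`, so that `Δ^K` is
  -- central. A word is then positive exactly when its positive translation is divisible by `Δ^(K *
  -- length)`.
  set K := e * ∑ s, N s with hK
  have hZ : ∀ g, Commute (Δ ^ K) g := fun g => by
    rw [hK, pow_mul]; exact (hcentral g).pow_left _
  have hT : ∀ s : Fin n × Bool, ∃ l : List (Fin k),
      (l.map σ).prod = Word.eval x [s] * Δ ^ K := fun s => by
    obtain ⟨l, hl⟩ := h.exists_list_prod_eq (g := Word.eval x [s] * Δ ^ K) (by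
      rw [← zpow_natCast, h.le_mul_zpow_iff, one_mul]
      refine le_trans (h.zpow_mono ?_) (hN1 s)
      have h1 : N s ≤ ∑ s, N s := Finset.single_le_sum (fun _ _ => Nat.zero_le _)
        (Finset.mem_univ s)
      have h2 : ∑ s, N s ≤ K := Nat.le_mul_of_pos_left _ he
      omega)
    choose f hf using fun g : Set.Icc 1 Δ => hex g g.2.1 g.2.2
    refine ⟨l.map f, ?_⟩
    rw [List.map_map, ← hl]
    congr 1
    exact List.map_congr_left fun a _ => hf a
  choose T hT using hT
  have hflat : ∀ w : Word n, ((w.flatMap T).map σ).prod =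
      Word.eval x w * Δ ^ (K * w.length) := fun w => by
    induction w with
    | nil => simp [Word.eval]
    | cons s w ih =>
      rw [List.flatMap_cons, List.map_append, List.prod_append, ih, hT, Word.eval_cons x s w,
        List.length_cons, Nat.mul_succ, mul_assoc, ← mul_assoc (Δ ^ K), (hZ _).eq, mul_assoc,
        ← pow_add, add_comm K]
      exact (mul_assoc _ _ _).symm
  have hiff : ∀ w : Word n,
      ((headStep hd tl o t)^[K * w.length] (true, w.flatMap T)).1 = true ↔
        1 ≤ Word.eval x w := fun w => by
    rw [headStep_iterate h (fun i => (hσ i).1) hinj ho ht hhd htl, hflat]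
    simpa using h.mul_pow_le_iff (K * w.length) (a := 1) (b := Word.eval x w)
  have hflatp : Primrec fun w : Word n => w.flatMap T :=
    Primrec.list_flatMap Primrec.id ((Primrec.dom_finite T).comp Primrec.snd).to₂
  have hp : Primrec fun w : Word n =>
      ((headStep hd tl o t)^[K * w.length] (true, w.flatMap T)).1 :=
    Primrec.fst.comp (Primrec.nat_iterate
      (Primrec.nat_mul.comp (Primrec.const K) Primrec.list_length)
      (Primrec.pair (Primrec.const true) hflatp)
      ((primrec_headStep hd tl o t).comp Primrec.snd).to₂)
  exact (PrimrecPred.of_eq (Primrec.primrecPred (p := fun w : Word n =>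
    ((headStep hd tl o t)^[K * w.length] (true, w.flatMap T)).1 = true) (by simpa using hp)) hiff)

end Head

end Garside

namespace Garside

/-! ### Algorithms -/

/-- Unbounded search over the codes of candidates terminates because a witness always exists. -/
theorem exists_computable_choice {α β : Type*} [Primcodable α] [Primcodable β]
    {R : α → β → Prop} (hR : PrimrecRel R) (hex : ∀ a, ∃ b, R a b) :
    ∃ f : α → β, Computable f ∧ ∀ a, R a (f a) := by
  classical
  let F : α → ℕ → Option β := fun a n =>
    (Encodable.decode (α := β) n).bind fun b => if R a b then some b else none
  have hF : Primrec₂ F := by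
    refine Primrec.option_bind (Primrec.decode.comp Primrec.snd) ?_
    refine Primrec.ite (c := fun q : (α × ℕ) × β => R q.1.1 q.2) ?_
      (Primrec.option_some.comp Primrec.snd) (Primrec.const none)
    exact hR.comp (Primrec.fst.comp Primrec.fst) Primrec.snd
  have hspec : ∀ a n b, b ∈ F a n → R a b := by
    intro a n b hb
    simp only [F, Option.mem_def, Option.bind_eq_some_iff] at hb
    obtain ⟨c, -, hc⟩ := hb
    split_ifs at hc with h
    obtain rfl : c = b := by simpa using hc
    exact h
  have hdom : ∀ a, (Nat.rfindOpt (F a)).Dom := fun a => by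
    obtain ⟨b, hb⟩ := hex a
    exact Nat.rfindOpt_dom.2 ⟨Encodable.encode b, b, by simp [F, hb]⟩
  refine ⟨fun a => (Nat.rfindOpt (F a)).get (hdom a), ?_, fun a => ?_⟩
  · exact (Partrec.rfindOpt hF.to_comp).of_eq_tot fun a => Part.get_mem _
  · obtain ⟨n, hn⟩ := Nat.rfindOpt_spec (Part.get_mem (hdom a))
    exact hspec a n _ hn

open Function in
-- Given the checkable identity `f^(2N) v = f^N v`, periodicity of `v` becomes the single test `f^N
-- v = v`.
theorem iterate_eq_of_mem_periodicPts {X : Type*} {f : X → X} {v : X} {N : ℕ} (hv : v ∈ periodicPts f)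
    (hN : f^[2 * N] v = f^[N] v) : f^[N] v = v := by
  obtain ⟨m, hm, hper⟩ := hv
  obtain ⟨m, rfl⟩ := Nat.exists_eq_succ_of_ne_zero hm.ne'
  have h1 : f^[m * N + N] v = v := by
    have := hper.mul_const N
    rwa [Nat.succ_mul] at this
  calc f^[N] v = f^[N] (f^[m * N + N] v) := by rw [h1]
    _ = f^[m * N] (f^[2 * N] v) := by
      rw [← iterate_add_apply, ← iterate_add_apply]; congr 1; ring
    _ = v := by rw [hN, ← iterate_add_apply, h1]

namespace IsGarsideOrder

variable {G : Type u} [Group G] [SemilatticeInf G] {Δ : G} {n : ℕ} {x : Fin n → G}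

theorem primrecRel_le (h : IsGarsideOrder Δ) (hx : Subgroup.closure (Set.range x) = ⊤) :
    PrimrecRel fun v w : Word n => Word.eval x v ≤ Word.eval x w := by
  have h1 : PrimrecRel fun v w : Word n => 1 ≤ Word.eval x (Word.inv v ++ w) :=
    (h.primrecPred_one_le hx).comp
      (Primrec.list_append.comp (Word.primrec_inv.comp Primrec.fst) Primrec.snd)
  refine h1.of_eq fun v w => ?_
  rw [Word.eval_append, Word.eval_inv, ← h.mul_le_mul_left_iff (a := Word.eval x v)]
  simp

theorem primrecRel_eq (h : IsGarsideOrder Δ) (hx : Subgroup.closure (Set.range x) = ⊤) :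
    PrimrecRel fun v w : Word n => Word.eval x v = Word.eval x w := by
  have h1 := h.primrecRel_le hx
  exact PrimrecPred.of_eq
    ((h1.comp Primrec.fst Primrec.snd).and (h1.comp Primrec.snd Primrec.fst))
    fun p => le_antisymm_iff.symm

theorem exists_pow_length_bounds (h : IsGarsideOrder Δ) (x : Fin n → G) :
    ∃ K : ℕ, ∀ w : Word n, Δ ^ (-(K * w.length : ℤ)) ≤ Word.eval x w ∧
      Word.eval x w ≤ Δ ^ (K * w.length : ℤ) := by
  choose N hN1 hN2 using fun s : Fin n × Bool => h.exists_zpow_bounds (Word.eval x [s])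
  refine ⟨∑ s, N s, fun w => ?_⟩
  induction w with
  | nil => simp [Word.eval]
  | cons s w ih =>
    have h1 : (N s : ℤ) ≤ (∑ s, N s : ℕ) := by
      exact_mod_cast Finset.single_le_sum (f := N) (fun _ _ => Nat.zero_le _) (Finset.mem_univ s)
    have e : (((∑ s, N s : ℕ) : ℤ) * ((s :: w).length : ℤ)) =
        (∑ s, N s : ℕ) + (∑ s, N s : ℕ) * (w.length : ℤ) := by
      rw [List.length_cons]; push_cast; ring
    rw [Word.eval_cons x s w, e, neg_add, zpow_add, zpow_add]
    constructor
    · refine ((h.mul_zpow_le_iff _).2 ?_).trans (h.mul_left_le _ _ _ ih.1)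
      exact (h.zpow_mono (by omega)).trans (hN1 s)
    · refine (h.mul_left_le _ _ _ ih.2).trans ((h.mul_zpow_le_iff _).2 ?_)
      exact (hN2 s).trans (h.zpow_mono (by omega))

/-- A word for the element `g * Δ ^ (-infimum g)` is computable from a word for `g`. -/
theorem exists_primrec_mul_zpow_infimum (h : IsGarsideOrder Δ)
    (hx : Subgroup.closure (Set.range x) = ⊤) :
    ∃ f : Word n → Word n, Primrec f ∧ ∀ w,
      Word.eval x (f w) = Word.eval x w * Δ ^ (-infimum Δ (Word.eval x w)) := by
  classical
  obtain ⟨K, hK⟩ := h.exists_pow_length_bounds x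
  obtain ⟨d, hd⟩ := Word.eval_surjective hx Δ
  -- The infimum lies between `-bound w` and `bound w`; shifting by `bound w` turns it into a
  -- bounded search over naturals.
  let bound : Word n → ℕ := fun w => K * w.length
  have hbound : Primrec bound := Primrec.nat_mul.comp (Primrec.const K) Primrec.list_length
  let P : Word n → ℕ → Prop := fun w i =>
    Word.eval x (Word.pow d i) ≤ Word.eval x (Word.pow d (bound w) ++ w)
  have hP : PrimrecRel P := (h.primrecRel_le hx).comp
    (Word.primrec_pow.comp (Primrec.const d) Primrec.snd)
    (Primrec.list_append.comp
      (Word.primrec_pow.comp (Primrec.const d) (hbound.comp Primrec.fst)) Primrec.fst)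
  let c : Word n → ℕ := fun w => Nat.findGreatest (P w) (2 * bound w)
  have hc : Primrec c := Primrec.nat_findGreatest
    (Primrec.nat_mul.comp (Primrec.const 2) hbound) hP
  have hPiff : ∀ w i, P w i ↔ (i : ℤ) - bound w ≤ infimum Δ (Word.eval x w) := fun w i => by
    simp only [P]
    rw [h.le_infimum_iff, Word.eval_append, Word.eval_pow, Word.eval_pow, hd,
      ← h.mul_le_mul_left_iff (a := Δ ^ bound w) (b := Δ ^ ((i : ℤ) - bound w)),
      ← zpow_natCast Δ (bound w), ← zpow_add, ← zpow_natCast Δ i]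
    congr! 2; ring
  have hinf : ∀ w, infimum Δ (Word.eval x w) = c w - bound w := fun w => by
    have hb : (bound w : ℤ) = K * w.length := by simp [bound]
    have h1 : -(bound w : ℤ) ≤ infimum Δ (Word.eval x w) := by
      rw [h.le_infimum_iff, hb]; exact (hK w).1
    have h2 : infimum Δ (Word.eval x w) ≤ bound w := by
      rw [← h.zpow_le_iff, hb]; exact (h.zpow_infimum_le _).trans (hK w).2
    obtain ⟨i, hi⟩ := Int.eq_ofNat_of_zero_le (show 0 ≤ infimum Δ (Word.eval x w) + bound w by omega)
    have h3 : c w = i := by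
      refine Nat.findGreatest_eq_iff.2 ⟨by omega, fun _ => (hPiff w i).2 (by omega), ?_⟩
      intro j hj _ hPj
      have := (hPiff w j).1 hPj
      omega
    rw [h3]; omega
  refine ⟨fun w => w ++ (Word.pow d (bound w) ++ Word.pow (Word.inv d) (c w)), ?_, fun w => ?_⟩
  · exact Primrec.list_append.comp Primrec.id (Primrec.list_append.comp
      (Word.primrec_pow.comp (Primrec.const d) hbound)
      (Word.primrec_pow.comp (Primrec.const _) hc))
  · rw [Word.eval_append, Word.eval_append, Word.eval_pow, Word.eval_pow, Word.eval_inv, hd,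
      hinf, neg_sub, sub_eq_add_neg, zpow_add, zpow_natCast, zpow_neg, zpow_natCast, inv_pow]

theorem exists_primrec_slide (h : IsGarsideOrder Δ)
    (hx : Subgroup.closure (Set.range x) = ⊤) :
    ∃ f : Word n → Word n, Primrec f ∧ ∀ w, Word.eval x (f w) = slide Δ (Word.eval x w) := by
  classical
  obtain ⟨k, σ, -, hrange⟩ := h.exists_enum
  obtain ⟨sh, hsh, hshe⟩ := h.exists_primrec_mul_zpow_infimum hx
  choose wd hwd using Word.eval_surjective hx
  let c : Word n → Fin k → Prop := fun w i =>
    Word.eval x (wd (σ i)) ≤ Word.eval x (sh w) ∧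
      Word.eval x (wd (σ i)) ≤ Word.eval x (sh (Word.inv w))
  have hwσ : Primrec fun i => wd (σ i) := Primrec.dom_finite _
  have hc : PrimrecRel c := PrimrecPred.and
    ((h.primrecRel_le hx).comp (hwσ.comp Primrec.snd) (hsh.comp Primrec.fst))
    ((h.primrecRel_le hx).comp (hwσ.comp Primrec.snd)
      (hsh.comp (Word.primrec_inv.comp Primrec.fst)))
  have hχ : Primrec fun (w : Word n) (i : Fin k) => decide (c w i) :=
    Primrec.fin_curry.2 hc.decide
  -- A simple element is determined by the set of simple elements below it. The prefix is therefore
  -- read off a finite table, indexed by the outcomes of finitely many order tests.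
  let D : (Fin k → Bool) → Word n := fun χ =>
    wd (Classical.epsilon fun g => g ∈ Set.Icc 1 Δ ∧ ∀ i, χ i = true ↔ σ i ≤ g)
  let p : Word n → Word n := fun w => D fun i => decide (c w i)
  have hp : Primrec p := (Primrec.dom_finite D).comp hχ
  have hpe : ∀ w, Word.eval x (p w) = pre Δ (Word.eval x w) := fun w => by
    have hpre : pre Δ (Word.eval x w) ∈ Set.Icc 1 Δ ∧
        ∀ i, decide (c w i) = true ↔ σ i ≤ pre Δ (Word.eval x w) := by
      refine ⟨⟨h.one_le_pre _, pre_le _⟩, fun i => ?_⟩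
      have hi : σ i ≤ Δ := (hrange ▸ Set.mem_range_self i : σ i ∈ Set.Icc 1 Δ).2
      simp only [c, decide_eq_true_eq, hwd, hshe, Word.eval_inv, pre, le_inf_iff, hi, true_and]
    have hspec := Classical.epsilon_spec (p := fun g => g ∈ Set.Icc 1 Δ ∧
      ∀ i, decide (c w i) = true ↔ σ i ≤ g) ⟨_, hpre⟩
    simp only [p, D, hwd]
    set g := Classical.epsilon fun g => g ∈ Set.Icc 1 Δ ∧ ∀ i, decide (c w i) = true ↔ σ i ≤ g
    obtain ⟨i, hi⟩ : g ∈ Set.range σ := hrange ▸ hspec.1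
    obtain ⟨j, hj⟩ : pre Δ (Word.eval x w) ∈ Set.range σ := hrange ▸ hpre.1
    apply le_antisymm
    · rw [← hi]; exact (hpre.2 i).1 ((hspec.2 i).2 hi.le)
    · rw [← hj]; exact (hspec.2 j).1 ((hpre.2 j).2 hj.le)
  refine ⟨fun w => Word.conj w (p w), Word.primrec_conj.comp Primrec.id hp, fun w => ?_⟩
  rw [Word.eval_conj, hpe, slide]

/-! ### Enumeration of sliding circuits and the conjugacy problem. -/

open Function

/-- `N` can be any positive common multiple of the eventual periods that is at least every
preperiod. -/
theorem exists_common_period (h : IsGarsideOrder Δ) {V : Set G} (hV : V.Finite) :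
    ∃ N : ℕ, 1 ≤ N ∧ ∀ v ∈ V, (slide Δ)^[2 * N] v = (slide Δ)^[N] v := by
  have hmul : ∀ (v : G) (N : ℕ), (slide Δ)^[2 * N] v = (slide Δ)^[N] v → ∀ m : ℕ,
      (slide Δ)^[(m + 1) * N] v = (slide Δ)^[N] v := fun v N hN m => by
    induction m with
    | zero => simp
    | succ m ih =>
      rw [show (m + 1 + 1) * N = m * N + 2 * N by ring, iterate_add_apply, hN,
        ← iterate_add_apply, ← ih]
      congr 1; ring
  have hmul' : ∀ (v : G) (N : ℕ), (slide Δ)^[2 * N] v = (slide Δ)^[N] v → ∀ m : ℕ, 1 ≤ m →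
      (slide Δ)^[2 * (m * N)] v = (slide Δ)^[m * N] v := fun v N hN m hm => by
    obtain ⟨m, rfl⟩ := Nat.exists_eq_add_of_le' hm
    rw [hmul v N hN, show 2 * ((m + 1) * N) = (2 * m + 1 + 1) * N by ring, hmul v N hN]
  induction V, hV using Set.Finite.induction_on with
  | empty => exact ⟨1, le_rfl, by simp⟩
  | @insert a V _ _ ih =>
    obtain ⟨N, hN, hNV⟩ := ih
    obtain ⟨i, j, hij, he⟩ := h.exists_iterate_eq_iterate a
    obtain ⟨d, rfl⟩ := Nat.exists_eq_add_of_lt hij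
    have hper : ∀ t q : ℕ, (slide Δ)^[i + t + q * (d + 1)] a = (slide Δ)^[i + t] a := by
      intro t q
      induction q with
      | zero => simp
      | succ q ih =>
        rw [← ih, show i + t + (q + 1) * (d + 1) = (t + q * (d + 1)) + (i + d + 1) by ring,
          iterate_add_apply, ← he, ← iterate_add_apply]
        congr 1; ring
    have ha : (slide Δ)^[2 * ((i + 1) * (d + 1))] a = (slide Δ)^[(i + 1) * (d + 1)] a := by
      have e : (i + 1) * (d + 1) = i + (i * d + d + 1) := by ring
      have := hper (i * d + d + 1) (i + 1)
      rw [← e] at this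
      rw [← this]; congr 1; ring
    refine ⟨N * ((i + 1) * (d + 1)), Nat.mul_pos hN (by positivity), ?_⟩
    rintro v (rfl | hv)
    · exact hmul' v _ ha N hN
    · rw [mul_comm N]
      exact hmul' v _ (hNV v hv) _ (Nat.mul_pos (Nat.succ_pos _) (Nat.succ_pos _))

/-- There is an algorithm which computes, from a word for `g`, a finite list of words for the
periodic points of the sliding which are conjugate to `g`. -/
theorem exists_computable_periodicPts_conj (h : IsGarsideOrder Δ)
    (hx : Subgroup.closure (Set.range x) = ⊤) :
    ∃ f : Word n → List (Word n), Computable f ∧ ∀ w,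
      {β | ∃ v ∈ f w, Word.eval x v = β} =
        {β | IsConj β (Word.eval x w) ∧ β ∈ periodicPts (slide Δ)} := by
  classical
  obtain ⟨S, hS, hSe⟩ := h.exists_primrec_slide hx
  have hSit : ∀ w m, Word.eval x (S^[m] w) = (slide Δ)^[m] (Word.eval x w) := fun w m => by
    induction m with
    | zero => rfl
    | succ m ih => rw [iterate_succ_apply', iterate_succ_apply', hSe, ih]
  choose wd hwd using Word.eval_surjective hx
  let A : Set G := Set.Icc 1 Δ ∪ (·⁻¹) '' Set.Icc 1 Δ
  have hA : A.Finite := (h.finite_Icc_all 1 Δ).union ((h.finite_Icc_all 1 Δ).image _)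
  let SL : List (Word n) := hA.toFinset.toList.map wd
  have hSL : ∀ s ∈ SL, Word.eval x s ∈ A := by
    intro s hs
    obtain ⟨a, ha, rfl⟩ := List.mem_map.1 hs
    rw [hwd]; simpa using ha
  have hSL' : ∀ a ∈ A, ∃ s ∈ SL, Word.eval x s = a := fun a ha =>
    ⟨wd a, List.mem_map_of_mem (by simpa using ha), hwd a⟩
  let it : ℕ → Word n → Word n := fun m v => S^[m] v
  have hit : Primrec₂ it :=
    Primrec.nat_iterate Primrec.fst Primrec.snd (hS.comp Primrec.snd).to₂
  let R1 : Word n → (Word n × ℕ × List (Word n)) → Prop := fun c q =>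
    Word.eval x (it q.2.1 (Word.conj q.1 c)) = Word.eval x (Word.conj q.1 c)
  let R2 : Word n → (Word n × Word n) → Prop := fun c' q =>
    Word.eval x (Word.conj q.1 c') = Word.eval x q.2
  let R3 : Word n → (Word n × (Word n × ℕ × List (Word n))) → Prop := fun s q =>
    Word.eval x (it (2 * q.2.2.1) (Word.conj q.2.1 (q.1 ++ s))) =
        Word.eval x (it q.2.2.1 (Word.conj q.2.1 (q.1 ++ s))) ∧
      (¬ Word.eval x (it q.2.2.1 (Word.conj q.2.1 (q.1 ++ s))) =
        Word.eval x (Word.conj q.2.1 (q.1 ++ s)) ∨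
        ∃ c' ∈ q.2.2.2, R2 c' (q.2.1, Word.conj q.2.1 (q.1 ++ s)))
  -- A decidable certificate `(N, L)`: `L` is a non-empty list of conjugators to points fixed by the
  -- `N`-th iterate. Each neighbour, by a simple element or an inverse of one, either fails to be
  -- periodic or is already represented in `L`. The first clause of `R3` makes `N` decisive for this
  -- test.
  let R : Word n → ℕ × List (Word n) → Prop := fun w q =>
    0 < q.1 ∧ q.2 ≠ [] ∧ (∀ c ∈ q.2, R1 c (w, q)) ∧ ∀ c ∈ q.2, ∀ s ∈ SL, R3 s (c, w, q)
  have heq := h.primrecRel_eq hx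
  have hR1 : PrimrecRel R1 := by
    have hcj : Primrec fun p : Word n × (Word n × ℕ × List (Word n)) => Word.conj p.2.1 p.1 :=
      Word.primrec_conj.comp (Primrec.fst.comp Primrec.snd) Primrec.fst
    exact heq.comp (hit.comp (Primrec.fst.comp (Primrec.snd.comp Primrec.snd)) hcj) hcj
  have hR2 : PrimrecRel R2 :=
    heq.comp (Word.primrec_conj.comp (Primrec.fst.comp Primrec.snd) Primrec.fst)
      (Primrec.snd.comp Primrec.snd)
  have hR3 : PrimrecRel R3 := by
    have hw : Primrec fun p : Word n × (Word n × (Word n × ℕ × List (Word n))) => p.2.2.1 :=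
      Primrec.fst.comp (Primrec.snd.comp Primrec.snd)
    have hN : Primrec fun p : Word n × (Word n × (Word n × ℕ × List (Word n))) => p.2.2.2.1 :=
      Primrec.fst.comp (Primrec.snd.comp (Primrec.snd.comp Primrec.snd))
    have hL : Primrec fun p : Word n × (Word n × (Word n × ℕ × List (Word n))) => p.2.2.2.2 :=
      Primrec.snd.comp (Primrec.snd.comp (Primrec.snd.comp Primrec.snd))
    have hcj : Primrec fun p : Word n × (Word n × (Word n × ℕ × List (Word n))) =>
        Word.conj p.2.2.1 (p.2.1 ++ p.1) :=
      Word.primrec_conj.comp hw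
        (Primrec.list_append.comp (Primrec.fst.comp Primrec.snd) Primrec.fst)
    refine PrimrecPred.and (heq.comp (hit.comp (Primrec.nat_mul.comp (Primrec.const 2) hN) hcj)
      (hit.comp hN hcj)) (PrimrecPred.or (heq.comp (hit.comp hN hcj) hcj).not ?_)
    exact hR2.exists_mem_list.comp hL (Primrec.pair hw hcj)
  have hR : PrimrecRel R := by
    have hL : Primrec fun p : Word n × (ℕ × List (Word n)) => p.2.2 :=
      Primrec.snd.comp Primrec.snd
    refine PrimrecPred.and (Primrec.nat_lt.comp (Primrec.const 0)
      (Primrec.fst.comp Primrec.snd)) (PrimrecPred.and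
      (Primrec.eq.comp hL (Primrec.const [])).not (PrimrecPred.and
      (hR1.forall_mem_list.comp hL Primrec.id) ?_))
    have h4 : PrimrecRel fun (c : Word n) (q : Word n × ℕ × List (Word n)) =>
        ∀ s ∈ SL, R3 s (c, q) := hR3.forall_mem_list.comp (Primrec.const SL) Primrec.id
    exact h4.forall_mem_list.comp hL Primrec.id
  -- A certificate exists: take conjugators for the finite set of all circuits, and a common `N` for
  -- these and their neighbours.
  have hex : ∀ w, ∃ q, R w q := by
    intro w
    set α := Word.eval x w with hα
    have hfin := h.finite_periodicPts_conj α
    have hconj : ∀ y, IsConj y α → ∃ c : Word n, Word.eval x (Word.conj w c) = y := fun y hy => by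
      obtain ⟨d, hd⟩ := isConj_iff.1 hy.symm
      obtain ⟨c, hc⟩ := Word.eval_surjective hx d⁻¹
      exact ⟨c, by rw [Word.eval_conj, hc, ← hd, inv_inv]⟩
    choose! cw hcw using hconj
    let L : List (Word n) := hfin.toFinset.toList.map cw
    have hL : ∀ c ∈ L, IsConj (Word.eval x (Word.conj w c)) α ∧
        Word.eval x (Word.conj w c) ∈ periodicPts (slide Δ) := by
      intro c hc
      obtain ⟨y, hy, rfl⟩ := List.mem_map.1 hc
      have hy' : IsConj y α ∧ y ∈ periodicPts (slide Δ) := by simpa using hy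
      rwa [hcw y hy'.1]
    have hL' : ∀ y, IsConj y α → y ∈ periodicPts (slide Δ) →
        ∃ c ∈ L, Word.eval x (Word.conj w c) = y := fun y h1 h2 =>
      ⟨cw y, List.mem_map_of_mem (Finset.mem_toList.2 (hfin.mem_toFinset.2 ⟨h1, h2⟩)), hcw y h1⟩
    obtain ⟨N, hN, hNV⟩ := h.exists_common_period (V :=
      {y | IsConj y α ∧ y ∈ periodicPts (slide Δ)} ∪
        (fun p : Word n × Word n => Word.eval x (Word.conj w (p.1 ++ p.2))) ''
          {p | p.1 ∈ L ∧ p.2 ∈ SL})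
      (hfin.union (Set.Finite.image _ (L.finite_toSet.prod SL.finite_toSet)))
    refine ⟨(N, L), hN, ?_, ?_, ?_⟩
    · obtain ⟨y, hy, hyα⟩ := h.exists_mem_periodicPts α
      obtain ⟨c, hc, -⟩ := hL' y hyα hy
      exact List.ne_nil_of_mem hc
    · intro c hc
      simp only [R1, it, hSit]
      exact iterate_eq_of_mem_periodicPts (hL c hc).2 (hNV _ (Or.inl (hL c hc)))
    · intro c hc s hs
      simp only [R3, R2, it, hSit]
      refine ⟨hNV _ (Or.inr ⟨(c, s), ⟨hc, hs⟩, rfl⟩), or_iff_not_imp_left.2 fun hper => ?_⟩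
      rw [not_not] at hper
      refine hL' _ ?_ ⟨N, hN, hper⟩
      exact (isConj_iff.2 ⟨(Word.eval x (c ++ s))⁻¹, by rw [Word.eval_conj, inv_inv]⟩ :
        IsConj α _).symm
  obtain ⟨f, hf, hfR⟩ := exists_computable_choice hR hex
  refine ⟨fun w => (f w).2.map (Word.conj w), ?_, fun w => ?_⟩
  · have : Primrec fun p : Word n × (ℕ × List (Word n)) => p.2.2.map (Word.conj p.1) :=
      Primrec.list_map (Primrec.snd.comp Primrec.snd)
        (Word.primrec_conj.comp (Primrec.fst.comp Primrec.fst) Primrec.snd).to₂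
    exact this.to_comp.comp (Computable.pair Computable.id hf)
  · obtain ⟨hN, hne, h1, h2⟩ := hfR w
    dsimp only
    generalize f w = q at *
    obtain ⟨N, L⟩ := q
    simp only [R1, R2, R3, it, hSit] at hN hne h1 h2 ⊢
    have hLc : ∀ c ∈ L, Word.eval x (Word.conj w c) ∈ periodicPts (slide Δ) := fun c hc =>
      ⟨N, hN, h1 c hc⟩
    have hLconj : ∀ c : Word n, IsConj (Word.eval x (Word.conj w c)) (Word.eval x w) := fun c =>
      (isConj_iff.2 ⟨(Word.eval x c)⁻¹, by rw [Word.eval_conj, inv_inv]⟩ :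
        IsConj (Word.eval x w) _).symm
    have hstep : ∀ c ∈ L, ∀ a ∈ A,
        a⁻¹ * Word.eval x (Word.conj w c) * a ∈ periodicPts (slide Δ) →
        ∃ c' ∈ L, Word.eval x (Word.conj w c') = a⁻¹ * Word.eval x (Word.conj w c) * a := by
      intro c hc a ha hper
      obtain ⟨s, hs, rfl⟩ := hSL' a ha
      have e : Word.eval x (Word.conj w (c ++ s)) =
          (Word.eval x s)⁻¹ * Word.eval x (Word.conj w c) * Word.eval x s := by
        simp only [Word.eval_conj, Word.eval_append]; group
      obtain ⟨h3, h4⟩ := h2 c hc s hs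
      rw [e] at h3 h4
      exact h4.resolve_left (not_not.2 (iterate_eq_of_mem_periodicPts hper h3))
    ext β
    constructor
    · rintro ⟨v, hv, rfl⟩
      obtain ⟨c, hc, rfl⟩ := List.mem_map.1 hv
      exact ⟨hLconj c, hLc c hc⟩
    · rintro ⟨hβ, hper⟩
      obtain ⟨c₀, hc₀⟩ := List.exists_mem_of_ne_nil L hne
      obtain ⟨d, hd⟩ := isConj_iff.1 ((hLconj c₀).trans hβ.symm)
      have hd' : d⁻¹⁻¹ * Word.eval x (Word.conj w c₀) * d⁻¹ = β := by rw [inv_inv, hd]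
      -- Any certificate is complete: membership in `L` propagates along the chain of simple
      -- conjugations. The inverses in `A` are needed to follow edges backwards.
      have key : ∃ c ∈ L, Word.eval x (Word.conj w c) =
          d⁻¹⁻¹ * Word.eval x (Word.conj w c₀) * d⁻¹ := by
        refine h.periodicPts_conj_induction
          (Q := fun y => ∃ c ∈ L, Word.eval x (Word.conj w c) = y) ?_ (hLc c₀ hc₀)
          (by rwa [hd']) ⟨c₀, hc₀, rfl⟩
        intro y hy a ha1 ha2 hya
        constructor
        · rintro ⟨c, hc, rfl⟩
          exact hstep c hc a (Or.inl ⟨ha1, ha2⟩) hya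
        · rintro ⟨c, hc, hcy⟩
          have e : a⁻¹⁻¹ * Word.eval x (Word.conj w c) * a⁻¹ = y := by rw [hcy]; group
          have := hstep c hc a⁻¹ (Or.inr ⟨a, ⟨ha1, ha2⟩, rfl⟩)
          rw [e] at this
          exact this hy
      obtain ⟨c, hc, hce⟩ := key
      exact ⟨Word.conj w c, List.mem_map_of_mem hc, hce.trans hd'⟩

/-- The conjugacy problem is decidable. -/
theorem computablePred_isConj (h : IsGarsideOrder Δ)
    (hx : Subgroup.closure (Set.range x) = ⊤) :
    ComputablePred fun p : Word n × Word n => IsConj (Word.eval x p.1) (Word.eval x p.2) := by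
  classical
  obtain ⟨f, hf, hfe⟩ := h.exists_computable_periodicPts_conj hx
  have hR : PrimrecRel fun L L' : List (Word n) =>
      ∃ v ∈ L, ∃ v' ∈ L', Word.eval x v' = Word.eval x v := by
    have h1 := (h.primrecRel_eq hx).exists_mem_list
    exact h1.swap.exists_mem_list
  have hiff : ∀ p : Word n × Word n, (∃ v ∈ f p.1, ∃ v' ∈ f p.2, Word.eval x v' = Word.eval x v) ↔
      IsConj (Word.eval x p.1) (Word.eval x p.2) := by
    intro p
    have mem : ∀ w β, (∃ v ∈ f w, Word.eval x v = β) ↔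
        IsConj β (Word.eval x w) ∧ β ∈ periodicPts (slide Δ) := fun w β =>
      Set.ext_iff.1 (hfe w) β
    constructor
    · rintro ⟨v, hv, v', hv', he⟩
      exact ((mem p.1 _).1 ⟨v, hv, rfl⟩).1.symm.trans ((mem p.2 _).1 ⟨v', hv', he⟩).1
    · intro hc
      obtain ⟨y, hy, hyc⟩ := h.exists_mem_periodicPts (Word.eval x p.1)
      obtain ⟨v, hv, rfl⟩ := (mem p.1 y).2 ⟨hyc, hy⟩
      obtain ⟨v', hv', he⟩ := (mem p.2 _).2 ⟨hyc.trans hc, hy⟩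
      exact ⟨v, hv, v', hv', he⟩
  refine ⟨inferInstance, ?_⟩
  have hcomp : Computable fun p : Word n × Word n =>
      decide (∃ v ∈ f p.1, ∃ v' ∈ f p.2, Word.eval x v' = Word.eval x v) :=
    (Primrec₂.to_comp hR.decide).comp (hf.comp Computable.fst) (hf.comp Computable.snd)
  exact hcomp.of_eq fun p => by simp only [hiff]

end IsGarsideOrder

end Garside

namespace Garside

/-! ### Sliding circuits in the group of fractions -/

namespace IsGarsideMonoid

variable {M : Type u} [Monoid M] {Δ : M}

theorem circuitGraph_connected (hM : IsGarsideMonoid M) (hΔ : IsGarsideElement Δ) (hΔ1 : Δ ≠ 1)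
    (α : FracGroup M) : (circuitGraph Δ α).Connected := by
  let _ := hM.semilatticeInf
  have h := hM.isGarsideOrder hΔ hΔ1
  obtain ⟨y, hy, hyα⟩ := h.exists_mem_periodicPts α
  have hadj : ∀ (β β' : SC Δ α) (a : M), a ∣ Δ →
      (β' : FracGroup M) = (ι a)⁻¹ * (β : FracGroup M) * ι a →
      (circuitGraph Δ α).Reachable β β' := fun β β' a ha he => by
    by_cases hne : β = β'
    · rw [hne]
    · exact SimpleGraph.Adj.reachable ((SimpleGraph.fromRel_adj _ _ _).2 ⟨hne, Or.inl ⟨a, ha, he⟩⟩)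
  have : Nonempty (SC Δ α) := ⟨⟨y, (hM.mem_SC_iff hΔ hΔ1).2 ⟨hyα, hy⟩⟩⟩
  refine ⟨fun β γ => ?_⟩
  obtain ⟨hβc, hβ⟩ := (hM.mem_SC_iff hΔ hΔ1).1 β.2
  obtain ⟨hγc, hγ⟩ := (hM.mem_SC_iff hΔ hΔ1).1 γ.2
  obtain ⟨d, hd⟩ := isConj_iff.1 (hβc.trans hγc.symm)
  have hd' : d⁻¹⁻¹ * (β : FracGroup M) * d⁻¹ = γ := by rw [inv_inv, hd]
  have key : ∃ δ : SC Δ α, (δ : FracGroup M) = d⁻¹⁻¹ * (β : FracGroup M) * d⁻¹ ∧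
      (circuitGraph Δ α).Reachable β δ := by
    refine h.periodicPts_conj_induction
      (Q := fun z => ∃ δ : SC Δ α, (δ : FracGroup M) = z ∧ (circuitGraph Δ α).Reachable β δ)
      ?_ hβ (by rwa [hd']) ⟨β, rfl, SimpleGraph.Reachable.refl β⟩
    intro z hz a ha1 ha2 hza
    obtain ⟨m, hm⟩ := ha1
    obtain rfl : a = ι m := by simpa using hm
    have hmΔ : m ∣ Δ := hM.leftLE_ι_iff.1 ha2
    have hzconj : IsConj z ((ι m)⁻¹ * z * ι m) := isConj_iff.2 ⟨(ι m)⁻¹, by simp⟩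
    constructor
    · rintro ⟨δ, rfl, hr⟩
      have hc := ((hM.mem_SC_iff hΔ hΔ1).1 δ.2).1
      let ε : SC Δ α := ⟨_, (hM.mem_SC_iff hΔ hΔ1).2 ⟨hzconj.symm.trans hc, hza⟩⟩
      exact ⟨ε, rfl, hr.trans (hadj δ ε m hmΔ rfl)⟩
    · rintro ⟨δ, hδ, hr⟩
      have hc := ((hM.mem_SC_iff hΔ hΔ1).1 δ.2).1
      rw [hδ] at hc
      let ε : SC Δ α := ⟨z, (hM.mem_SC_iff hΔ hΔ1).2 ⟨hzconj.trans hc, hz⟩⟩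
      exact ⟨ε, rfl, hr.trans (hadj ε δ m hmΔ hδ).symm⟩
  obtain ⟨δ, hδ, hr⟩ := key
  rwa [Subtype.ext (hδ.trans hd')] at hr

end IsGarsideMonoid

theorem circuitGraph_connected_of_subsingleton {M : Type u} [Monoid M] (Δ : M)
    [Subsingleton (FracGroup M)] (α : FracGroup M) : (circuitGraph Δ α).Connected := by
  have : Nonempty (SC Δ α) := ⟨⟨α, IsConj.refl α, 1, le_rfl, Subsingleton.elim _ _⟩⟩
  exact ⟨fun β γ => by rw [Subsingleton.elim β γ]⟩

end Garside

/-! ### Connectedness and the algorithms for a Garside group. -/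

theorem corollary4p16 {M : Type*} [Monoid M] (hM : Garside.IsGarsideMonoid M)
    (Δ : M) (hΔ : Garside.IsGarsideElement Δ) :
    -- the graph on the sliding circuits is connected
    (∀ α : Garside.FracGroup M, (Garside.circuitGraph Δ α).Connected) ∧
    -- algorithms, for words over any finite generating family of the group
    (∀ (n : ℕ) (x : Fin n → Garside.FracGroup M), Subgroup.closure (Set.range x) = ⊤ →
      -- computing the set of sliding circuits
      (∃ f : Garside.Word n → List (Garside.Word n), Computable f ∧
        ∀ w, {β | ∃ v ∈ f w, Garside.Word.eval x v = β} = Garside.SC Δ (Garside.Word.eval x w)) ∧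
      -- deciding conjugacy
      ComputablePred fun p : Garside.Word n × Garside.Word n =>
        IsConj (Garside.Word.eval x p.1) (Garside.Word.eval x p.2)) := by
  -- If `Δ = 1` the group is trivial and no greatest `p` exists, so normal forms carry no
  -- information; everything then holds because the group has one element, represented by the empty
  -- word.
  by_cases hΔ1 : Δ = 1
  · subst hΔ1
    have hsub := hM.subsingleton_of_garside_eq_one hΔ
    refine ⟨fun α => Garside.circuitGraph_connected_of_subsingleton 1 α, fun n x _ => ⟨?_, ?_⟩⟩
    · refine ⟨fun _ => [[]], Computable.const _, fun w => ?_⟩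
      ext β
      exact ⟨fun _ => ⟨isConj_iff.2 ⟨1, Subsingleton.elim _ _⟩, 1, le_rfl, Subsingleton.elim _ _⟩,
        fun _ => ⟨[], by simp, Subsingleton.elim _ _⟩⟩
    · refine PrimrecPred.computablePred (PrimrecPred.of_eq (Primrec.eq.comp (Primrec.const 0)
        (Primrec.const 0)) fun p => ?_)
      exact ⟨fun _ => isConj_iff.2 ⟨1, Subsingleton.elim _ _⟩, fun _ => rfl⟩
  · let _ := hM.semilatticeInf
    have h := hM.isGarsideOrder hΔ hΔ1
    refine ⟨fun α => hM.circuitGraph_connected hΔ hΔ1 α, fun n x hx => ⟨?_, ?_⟩⟩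
    · obtain ⟨f, hf, hfe⟩ := h.exists_computable_periodicPts_conj hx
      refine ⟨f, hf, fun w => ?_⟩
      rw [hfe w]
      ext β
      exact (hM.mem_SC_iff hΔ hΔ1).symm
    · exact h.computablePred_isConj hx
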